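/- Let $n\in\mathbb N$, $n\ge 2$, let $\alpha,\beta,\gamma,\tau\in\mathbb R$, and let $f\colon\mathbb R^n\to\mathbb C$ be infinitely differentiable with compact support contained in $\mathbb R^n\setminus\{0\}$. Let $d\omega$ be the usual surface measure on the unit sphere $\mathbb S^{n-1}$, let $-\Delta_{\mathbb S^{n-1}}$ be the nonnegative self-adjoint Laplace--Beltrami operator in $L^2(\mathbb S^{n-1};d\omega)$, let $(-\Delta_{\mathbb S^{n-1}})^{1/2}$ be its nonnegative self-adjoint square root, and let $(r,\theta)\in(0,\infty)\times\mathbb S^{n-1}$ be polar coordinates in $\mathbb R^n\setminus\{0\}$; all three operators $(-\Delta_{\mathbb S^{n-1}})^{1/2}$, $\Delta_{\mathbb S^{n-1}}$, $\partial/\partial r$ are applied to $f=f(r,\theta)$ in the respective variable. Put $$A=\int_0^\infty\!\!\int_{\mathbb S^{n-1}} r^{\gamma-4}\big|\big((-\Delta_{\mathbb S^{n-1}})^{1/2}f\big)(r,\theta)\big|^2\,d\omega(\theta)\,r^{n-1}dr,$$ $$B=\int_0^\infty\!\!\int_{\mathbb S^{n-1}} r^{\gamma-2}\Big|\Big((-\Delta_{\mathbb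 S^{n-1}})^{1/2}\frac{\partial f}{\partial r}\Big)(r,\theta)\Big|^2\,d\omega(\theta)\,r^{n-1}dr,$$ $$C=\int_0^\infty\!\!\int_{\mathbb S^{n-1}} r^{\gamma-4}\big|(\Delta_{\mathbb S^{n-1}}f)(r,\theta)\big|^2\,d\omega(\theta)\,r^{n-1}dr.$$ For every $r>0$ the functions $f(r,\cdot)$ and $(\partial f/\partial r)(r,\cdot)$ belong to the domain of $(-\Delta_{\mathbb S^{n-1}})^{1/2}$, the integrals $A,B,C$ are finite, and $$\begin{aligned} \int_{\mathbb R^n}|x|^\gamma|(\Delta f)(x)|^2\,d^nx\ \ge\ & [\alpha(\gamma+n-4)-2\beta]\int_{\mathbb R^n}|x|^{\gamma-2}|(\nabla f)(x)|^2\,d^nx\\ &-\alpha(\alpha-4+2\gamma)\int_{\mathbb R^n}|x|^{\gamma-4}|x\cdot(\nabla f)(x)|^2\,d^nx\\ &+\beta[(n-4)(\alpha-2)-\beta+\gamma(n+\alpha+\gamma-6)]\int_{\mathbb R^n}|x|^{\gamma-4}|f(x)|^2\,d^nx\\ &-\tau[(\gamma+n-4)(2-\alpha-\gamma)+2\beta]\,A-2\tau\,B-\tau(\tau+2)\,C.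 \end{aligned}$$ If, in addition, $\alpha(\alpha-4+2\gamma)\ge 0$, then $$\begin{aligned} \int_{\mathbb R^n}|x|^\gamma|(\Delta f)(x)|^2\,d^nx\ \ge\ & [\alpha(n-\alpha-\gamma)-2\beta]\int_{\mathbb R^n}|x|^{\gamma-2}|(\nabla f)(x)|^2\,d^nx\\ &+\beta[(n-4)(\alpha-2)-\beta+\gamma(n+\alpha+\gamma-6)]\int_{\mathbb R^n}|x|^{\gamma-4}|f(x)|^2\,d^nx\\ &-\tau[(\gamma+n-4)(2-\alpha-\gamma)+2\beta]\,A-2\tau\,B-\tau(\tau+2)\,C. \end{aligned}$$ -/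

import Mathlib

open MeasureTheory Set
open scoped ContDiff

noncomputable section

/-- The unit sphere `S^{n-1}` of `ℝⁿ`. -/
abbrev USphere (n : ℕ) : Type := Metric.sphere (0 : EuclideanSpace ℝ (Fin n)) 1

/-- The usual surface measure on `S^{n-1}`. -/
abbrev sphereMeasure (n : ℕ) : Measure (USphere n) :=
  (volume : Measure (EuclideanSpace ℝ (Fin n))).toSphere

/-- The Hilbert space `L²(S^{n-1})` of complex-valued functions. -/
abbrev SphereL2 (n : ℕ) : Type := Lp ℂ 2 (sphereMeasure n)

/-- The extension `x ↦ u (x / |x|)` of a function on the sphere to `ℝⁿ \ {0}`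
(with the value `0` at the origin). -/
def homExt {n : ℕ} (u : USphere n → ℂ) (x : EuclideanSpace ℝ (Fin n)) : ℂ :=
  if hx : x = 0 then 0
  else u ⟨‖x‖⁻¹ • x, by
    rw [mem_sphere_zero_iff_norm, norm_smul, norm_inv, norm_norm,
      inv_mul_cancel₀ (norm_ne_zero_iff.mpr hx)]⟩

/-- Smoothness of a function on the sphere: its extension, constant along rays, is smooth
on `ℝⁿ \ {0}`. -/
def SphereSmooth {n : ℕ} (u : USphere n → ℂ) : Prop :=
  ContDiffOn ℝ ∞ (homExt u) {0}ᶜ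

/-- The (classical) Laplace-Beltrami operator `Δ_S` on functions on the sphere: by
`Δ = ∂_r² + (n-1) r⁻¹ ∂_r + r⁻² Δ_S`, it is the Laplacian on `ℝⁿ` of the extension that is
constant along rays, restricted to the sphere. -/
def sphereLaplacian {n : ℕ} (u : USphere n → ℂ) (θ : USphere n) : ℂ :=
  Laplacian.laplacian (homExt u) (θ : EuclideanSpace ℝ (Fin n))

/-- The graph in `L² × L²` of the nonnegative self-adjoint operator `-Δ_S`, that is, the closure
of the graph of `-Δ_S` on smooth functions (on which it is essentially self-adjoint). -/
def negLaplacianGraph (n : ℕ) : Submodule ℂ (SphereL2 n × SphereL2 n) :=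
  (Submodule.span ℂ {p : SphereL2 n × SphereL2 n | ∃ u : USphere n → ℂ, SphereSmooth u ∧
    p.1 =ᵐ[sphereMeasure n] u ∧
    p.2 =ᵐ[sphereMeasure n] fun θ => -sphereLaplacian u θ}).topologicalClosure

/-- The eigenspace `ker (-Δ_S - μ)` of the self-adjoint operator `-Δ_S` in `L²(S^{n-1})`. -/
def sphereEigenspace (n : ℕ) (μ : ℝ) : Submodule ℂ (SphereL2 n) :=
  (negLaplacianGraph n).comap
    ((ContinuousLinearMap.id ℂ (SphereL2 n)).prod
      ((μ : ℂ) • ContinuousLinearMap.id ℂ (SphereL2 n))).toLinearMap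

theorem mem_sphereEigenspace {n : ℕ} {μ : ℝ} {u : SphereL2 n} :
    u ∈ sphereEigenspace n μ ↔ (u, (μ : ℂ) • u) ∈ negLaplacianGraph n :=
  Iff.rfl

theorem isClosed_sphereEigenspace (n : ℕ) (μ : ℝ) :
    IsClosed (sphereEigenspace n μ : Set (SphereL2 n)) :=
  (Submodule.isClosed_topologicalClosure _).preimage (ContinuousLinearMap.continuous _)

instance completeSpace_sphereEigenspace (n : ℕ) (μ : ℝ) :
    CompleteSpace (sphereEigenspace n μ) :=
  (isClosed_sphereEigenspace n μ).completeSpace_coe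

/-- The spectral projection of `-Δ_S` onto the eigenspace for `μ`. -/
def sphereProj (n : ℕ) (μ : ℝ) : SphereL2 n →L[ℂ] SphereL2 n :=
  (sphereEigenspace n μ).starProjection

/-- The domain of `(-Δ_S)^{1/2}`: as `-Δ_S` has pure point spectrum, it consists of the `u` for
which the orthogonal series `∑_μ μ^{1/2} P_μ u` over the eigenvalues converges in `L²`
(for `μ` not an eigenvalue, `P_μ = 0`). -/
def sphereSqrtDomain (n : ℕ) : Submodule ℂ (SphereL2 n) where
  carrier := {u | Summable fun μ : ℝ => (√μ : ℂ) • sphereProj n μ u}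
  add_mem' := by
    intro u v hu hv
    simpa only [mem_ofPred_eq, map_add, smul_add] using Summable.add hu hv
  zero_mem' := by
    simpa only [mem_ofPred_eq, map_zero, smul_zero] using summable_zero
  smul_mem' := by
    intro c u hu
    have h := Summable.const_smul c hu
    simp only [smul_comm c] at h
    simpa only [mem_ofPred_eq, map_smul] using h

/-- The square root `(-Δ_S)^{1/2}` of the nonnegative self-adjoint operator `-Δ_S`, given by the
functional calculus: `(-Δ_S)^{1/2} u = ∑_μ μ^{1/2} P_μ u` on its domain (and `0` elsewhere). -/
def sphereSqrt (n : ℕ) (u : SphereL2 n) : SphereL2 n :=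
  ∑' μ : ℝ, (√μ : ℂ) • sphereProj n μ u

open Classical in
/-- The element of `L²(S^{n-1})` given by a square integrable function (`0` for others). -/
def toSphereL2 {n : ℕ} (u : USphere n → ℂ) : SphereL2 n :=
  if h : MemLp u 2 (sphereMeasure n) then h.toLp u else 0

/-- The function `θ ↦ f (r, θ)` on the sphere, in polar coordinates. -/
def polar {n : ℕ} (f : EuclideanSpace ℝ (Fin n) → ℂ) (r : ℝ) (θ : USphere n) : ℂ :=
  f (r • (θ : EuclideanSpace ℝ (Fin n)))

/-- The function `θ ↦ (∂f/∂r) (r, θ)` on the sphere, in polar coordinates. -/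
def polarDeriv {n : ℕ} (f : EuclideanSpace ℝ (Fin n) → ℂ) (r : ℝ) (θ : USphere n) : ℂ :=
  deriv (fun s : ℝ => polar f s θ) r

/-- The squared length `|∇f|² = ∑ᵢ |∂ᵢ f|²` of the gradient of a complex-valued function. -/
def gradSq {n : ℕ} (f : EuclideanSpace ℝ (Fin n) → ℂ) (x : EuclideanSpace ℝ (Fin n)) : ℝ :=
  ∑ i : Fin n, ‖fderiv ℝ f x (EuclideanSpace.single i 1)‖ ^ 2

/-- The radial integrand `r ↦ (∫_S r^p |(-Δ_S)^{1/2} f (r, θ)|² dω(θ)) r^{n-1}`. -/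
def sqrtTerm {n : ℕ} (p : ℝ) (f : EuclideanSpace ℝ (Fin n) → ℂ) (r : ℝ) : ℝ :=
  (∫ θ : USphere n, r ^ p * ‖sphereSqrt n (toSphereL2 (polar f r)) θ‖ ^ 2 ∂sphereMeasure n)
    * r ^ (n - 1)

/-- The radial integrand `r ↦ (∫_S r^p |(-Δ_S)^{1/2} (∂f/∂r) (r, θ)|² dω(θ)) r^{n-1}`. -/
def sqrtDerivTerm {n : ℕ} (p : ℝ) (f : EuclideanSpace ℝ (Fin n) → ℂ) (r : ℝ) : ℝ :=
  (∫ θ : USphere n, r ^ p * ‖sphereSqrt n (toSphereL2 (polarDeriv f r)) θ‖ ^ 2 ∂sphereMeasure n)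
    * r ^ (n - 1)

/-- The radial integrand `r ↦ (∫_S r^p |(Δ_S f) (r, θ)|² dω(θ)) r^{n-1}`. -/
def lapTerm {n : ℕ} (p : ℝ) (f : EuclideanSpace ℝ (Fin n) → ℂ) (r : ℝ) : ℝ :=
  (∫ θ : USphere n, r ^ p * ‖sphereLaplacian (polar f r) θ‖ ^ 2 ∂sphereMeasure n)
    * r ^ (n - 1)

end

/-!
The proof is the factorization method. In polar coordinates `r² Δ = (r ∂_r)² + (n - 2) r ∂_r + Δ_S`,
and the inequality says that the integral of `|x|^{γ-4} |T f|²` is nonnegative, where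
`T f = r² Δ f - (α r ∂_r f + β f - τ Δ_S f)`: expanding the square and integrating by parts turns it
into the difference of the two sides (`pairing_self_combination`). The second inequality follows
since `|x · ∇f|² ≤ |x|² |∇f|²`.

All integrations by parts are done on `ℝⁿ \ {0}`, for derivatives along linear vector fields. The
identity field gives `r ∂_r`, whose adjoint for the weight `|x|^s` is `-r ∂_r - (s + n)`. The
rotation fields `xᵢ ∂ⱼ - xⱼ ∂ᵢ` are skew-adjoint for every radial weight and commute with `r ∂_r`,
and `½ ∑ᵢⱼ (xᵢ ∂ⱼ - xⱼ ∂ᵢ)²` is the angular part of the Laplacian (`norm_sq_smul_laplacian`), which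
on functions constant along rays is `Δ_S` (`sphereLaplacian_polar`). Integrating against a radial
bump function transfers its symmetry and its sign to the sphere.

It remains to see that `‖(-Δ_S)^{1/2} u‖² = ⟪u, -Δ_S u⟫` for smooth `u`, with the square root
defined through the eigenspaces (`mem_sphereSqrtDomain_and_norm_sq`). This needs that the eigenspaces
are total. The restrictions to the sphere of polynomials of degree at most `k` form a
finite-dimensional space which is invariant under the rotation fields, hence under the symmetric
operator `Δ_S`, so that it is spanned by eigenvectors (`le_iSup_eigenspaces`); by the
Stone-Weierstrass theorem these spaces are together dense. No explicit spherical harmonics are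
needed.
-/

/-! ### Derivatives along linear vector fields -/

section LinearVectorFields

open Filter Topology

variable {E F : Type*} [NormedAddCommGroup E] [InnerProductSpace ℝ E]
  [NormedAddCommGroup F] [InnerProductSpace ℝ F]

/-- The derivative of `f` along the linear vector field `x ↦ A x`. For `A = 1` this is the Euler
operator `x · ∇ = r ∂_r`, for skew `A` it is an infinitesimal rotation. -/
noncomputable def linDeriv (A : E →L[ℝ] E) (f : E → F) (x : E) : F := fderiv ℝ f x (A x)

/-- The functions in `C_c^∞` whose support does not contain the origin. -/
structure IsTest (f : E → F) : Prop where
  contDiff : ContDiff ℝ ∞ f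
  compact : HasCompactSupport f
  zero_notMem : (0 : E) ∉ tsupport f

theorem contDiffAt_of_ne_zero {f : E → F} (hf : ContDiffOn ℝ ∞ f {0}ᶜ) {x : E} (hx : x ≠ 0) :
    ContDiffAt ℝ ∞ f x :=
  hf.contDiffAt (isOpen_compl_singleton.mem_nhds hx)

theorem differentiableAt_of_ne_zero {f : E → F} (hf : ContDiffOn ℝ ∞ f {0}ᶜ) {x : E}
    (hx : x ≠ 0) : DifferentiableAt ℝ f x :=
  (contDiffAt_of_ne_zero hf hx).differentiableAt (by simp)

theorem IsTest.contDiffOn {f : E → F} (hf : IsTest f) : ContDiffOn ℝ ∞ f {0}ᶜ :=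
  hf.contDiff.contDiffOn

theorem IsTest.of_support_subset {G : Type*} [NormedAddCommGroup G] [InnerProductSpace ℝ G]
    {f : E → F} {g : E → G} (hg : IsTest g)
    (hf : ContDiffOn ℝ ∞ f {0}ᶜ) (h : Function.support f ⊆ tsupport g) : IsTest f := by
  have hs : tsupport f ⊆ tsupport g := closure_minimal h (isClosed_tsupport g)
  have h0 : (0 : E) ∉ tsupport f := fun h' => hg.zero_notMem (hs h')
  refine ⟨contDiff_iff_contDiffAt.2 fun x => ?_, hg.compact.of_isClosed_subset
    (isClosed_tsupport f) hs, h0⟩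
  by_cases hx : x = 0
  · subst hx
    exact contDiffAt_const.congr_of_eventuallyEq (notMem_tsupport_iff_eventuallyEq.1 h0)
  · exact contDiffAt_of_ne_zero hf hx

theorem contDiffOn_linDeriv (A : E →L[ℝ] E) {f : E → F} (hf : ContDiffOn ℝ ∞ f {0}ᶜ) :
    ContDiffOn ℝ ∞ (linDeriv A f) {0}ᶜ :=
  (hf.fderiv_of_isOpen isOpen_compl_singleton (by simp)).clm_apply A.contDiff.contDiffOn

theorem IsTest.linDeriv (A : E →L[ℝ] E) {f : E → F} (hf : IsTest f) :
    IsTest (linDeriv A f) := by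
  refine hf.of_support_subset (contDiffOn_linDeriv A hf.contDiffOn) fun x hx => ?_
  by_contra h
  refine hx ?_
  have : fderiv ℝ f x = 0 := by
    by_contra h'
    exact h (support_fderiv_subset ℝ h')
  simp [_root_.linDeriv, this]

theorem linDeriv_zero_right (A : E →L[ℝ] E) (f : E → F) : linDeriv A f 0 = 0 := by
  simp [linDeriv]

theorem linDeriv_congr (A : E →L[ℝ] E) {f g : E → F} {x : E} (h : f =ᶠ[𝓝 x] g) :
    linDeriv A f x = linDeriv A g x := by
  rw [linDeriv, linDeriv, h.fderiv_eq]

theorem linDeriv_linDeriv (A B : E →L[ℝ] E) {f : E → F} {x : E} (hf : ContDiffAt ℝ 2 f x) :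
    linDeriv A (linDeriv B f) x
      = fderiv ℝ (fderiv ℝ f) x (A x) (B x) + fderiv ℝ f x (B (A x)) := by
  have h1 : DifferentiableAt ℝ (fderiv ℝ f) x :=
    (hf.fderiv_right (m := 1) (by norm_num)).differentiableAt (by simp)
  have := (h1.hasFDerivAt.clm_apply (B.hasFDerivAt (x := x))).fderiv
  change fderiv ℝ (fun y => fderiv ℝ f y (B y)) x (A x) = _
  rw [this]
  simp [add_comm]

/-- Every linear vector field commutes with the Euler field. -/
theorem linDeriv_id_comm (A : E →L[ℝ] E) {f : E → F} {x : E} (hf : ContDiffAt ℝ 2 f x) :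
    linDeriv A (linDeriv (.id ℝ E) f) x = linDeriv (.id ℝ E) (linDeriv A f) x := by
  rw [linDeriv_linDeriv _ _ hf, linDeriv_linDeriv _ _ hf]
  have := (hf.isSymmSndFDerivAt (by simp)).eq (A x) x
  simp [this]

theorem linDeriv_mul_inner (A : E →L[ℝ] E) {W : E → ℝ} {a b : E → F} {x : E}
    (hW : DifferentiableAt ℝ W x) (ha : DifferentiableAt ℝ a x) (hb : DifferentiableAt ℝ b x) :
    linDeriv A (fun y => W y * inner ℝ (a y) (b y)) x
      = linDeriv A W x * inner ℝ (a x) (b x) + W x * inner ℝ (linDeriv A a x) (b x)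
        + W x * inner ℝ (a x) (linDeriv A b x) := by
  have h2 : DifferentiableAt ℝ (fun y => inner ℝ (a y) (b y)) x := ha.inner ℝ hb
  simp only [linDeriv]
  rw [fderiv_fun_mul hW h2]
  simp [fderiv_inner_apply ℝ ha hb]
  ring

/-- The derivative of a radial function along a linear vector field. -/
theorem linDeriv_radial (A : E →L[ℝ] E) {ψ : ℝ → ℝ} {ψ' : ℝ} {x : E}
    (h : HasDerivAt ψ ψ' (‖x‖ ^ 2)) :
    linDeriv A (fun y => ψ (‖y‖ ^ 2)) x = ψ' * (2 * inner ℝ x (A x)) := by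
  have h2 : HasFDerivAt (fun y : E => ‖y‖ ^ 2) (2 • innerSL ℝ x) x :=
    (hasStrictFDerivAt_norm_sq x).hasFDerivAt
  have := (h.comp_hasFDerivAt x h2).fderiv
  change fderiv ℝ (ψ ∘ fun y => ‖y‖ ^ 2) x (A x) = _
  rw [this]
  simp

theorem linDeriv_norm_rpow (A : E →L[ℝ] E) (s : ℝ) {x : E} (hx : x ≠ 0) :
    linDeriv A (fun y => ‖y‖ ^ s) x = s * ‖x‖ ^ (s - 2) * inner ℝ x (A x) := by
  have hp : 0 < ‖x‖ := norm_pos_iff.2 hx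
  have h := linDeriv_radial A (ψ := fun t => t ^ (s / 2)) (x := x)
    (Real.hasDerivAt_rpow_const (Or.inl (by positivity)))
  have e : (fun y : E => (‖y‖ ^ 2) ^ (s / 2)) = fun y => ‖y‖ ^ s := by
    funext y
    rw [← Real.rpow_natCast, ← Real.rpow_mul (norm_nonneg y)]
    congr 1; push_cast; ring
  simp only [e] at h
  rw [h, ← Real.rpow_natCast, ← Real.rpow_mul hp.le]
  have : ((2 : ℕ) : ℝ) * (s / 2 - 1) = s - 2 := by push_cast; ring
  rw [this]; ring

theorem contDiffOn_norm_rpow (s : ℝ) : ContDiffOn ℝ ∞ (fun y : E => ‖y‖ ^ s) {0}ᶜ := by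
  intro x hx
  exact ((contDiffAt_norm ℝ hx).rpow_const_of_ne (norm_ne_zero_iff.2 hx)).contDiffWithinAt

theorem contDiffOn_mul_inner {W : E → ℝ} {a b : E → F} (hW : ContDiffOn ℝ ∞ W {0}ᶜ)
    (ha : ContDiffOn ℝ ∞ a {0}ᶜ) (hb : ContDiffOn ℝ ∞ b {0}ᶜ) :
    ContDiffOn ℝ ∞ (fun y => W y * inner ℝ (a y) (b y)) {0}ᶜ :=
  hW.mul (ha.inner ℝ hb)

theorem isTest_mul_inner {W : E → ℝ} {a b : E → F} (hW : ContDiffOn ℝ ∞ W {0}ᶜ)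
    (ha : ContDiffOn ℝ ∞ a {0}ᶜ) (hb : ContDiffOn ℝ ∞ b {0}ᶜ) (h : IsTest W ∨ IsTest a) :
    IsTest (fun y => W y * inner ℝ (a y) (b y)) := by
  rcases h with h | h
  · refine h.of_support_subset (contDiffOn_mul_inner hW ha hb) fun x hx => subset_tsupport _ ?_
    intro h0
    exact hx (by simp [h0])
  · refine h.of_support_subset (contDiffOn_mul_inner hW ha hb) fun x hx => subset_tsupport _ ?_
    intro h0
    exact hx (by simp [h0])

theorem IsTest.integrable [MeasurableSpace E] [BorelSpace E] {f : E → F} (hf : IsTest f)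
    {μ : Measure E} [IsFiniteMeasureOnCompacts μ] : Integrable f μ :=
  hf.contDiff.continuous.integrable_of_hasCompactSupport hf.compact

end LinearVectorFields

/-! ### Integration by parts along linear vector fields -/

section IntegrationByParts

variable {n : ℕ} {F : Type*} [NormedAddCommGroup F] [InnerProductSpace ℝ F]

local notation "𝔼" => EuclideanSpace ℝ (Fin n)

/-- The trace of an endomorphism of `ℝⁿ`, that is, the divergence of the linear vector field. -/
noncomputable def linTrace (A : 𝔼 →L[ℝ] 𝔼) : ℝ := ∑ j, (A (EuclideanSpace.single j 1)) j

theorem euclidean_sum_single (x : 𝔼) : ∑ j, x j • EuclideanSpace.single j (1 : ℝ) = x := by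
  ext i
  simp [Finset.sum_apply, Pi.single_apply]

theorem integral_linDeriv (A : 𝔼 →L[ℝ] 𝔼) {k : 𝔼 → ℝ} (hk : IsTest k) :
    ∫ x, linDeriv A k x = -(linTrace A * ∫ x, k x) := by
  have h1 : ∀ x, linDeriv A k x
      = ∑ j, (A x) j * fderiv ℝ k x (EuclideanSpace.single j 1) := by
    intro x
    rw [linDeriv]
    conv_lhs => rw [← euclidean_sum_single (A x)]
    simp
  have hd : Differentiable ℝ k := hk.contDiff.differentiable (by simp)
  have hcA : ∀ j, Continuous fun x : 𝔼 => (A x) j := fun j => by fun_prop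
  have hD : ∀ j : Fin n, Continuous fun x => fderiv ℝ k x (EuclideanSpace.single j 1) := fun j =>
    (hk.contDiff.continuous_fderiv (by simp)).clm_apply continuous_const
  have hDc : ∀ j : Fin n, HasCompactSupport fun x => fderiv ℝ k x (EuclideanSpace.single j 1) :=
    fun j => hk.compact.fderiv_apply ℝ _
  have hAd : ∀ (j : Fin n) (x v : 𝔼), fderiv ℝ (fun x : 𝔼 => (A x) j) x v = (A v) j := by
    intro j x v
    have : (fun x : 𝔼 => (A x) j) = ((EuclideanSpace.proj (𝕜 := ℝ) j).comp A : 𝔼 →L[ℝ] ℝ) := by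
      ext; simp
    rw [this, ContinuousLinearMap.fderiv]
    simp
  have h2 : ∀ j : Fin n, ∫ x, (A x) j * fderiv ℝ k x (EuclideanSpace.single j 1)
      = -((A (EuclideanSpace.single j 1)) j * ∫ x, k x) := by
    intro j
    rw [integral_mul_fderiv_eq_neg_fderiv_mul_of_integrable]
    · simp only [hAd]
      rw [integral_const_mul]
    · simp only [hAd]
      exact (hk.integrable).const_mul _
    · exact ((hcA j).mul (hD j)).integrable_of_hasCompactSupport (hDc j).mul_left
    · exact ((hcA j).mul hk.contDiff.continuous).integrable_of_hasCompactSupport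
        hk.compact.mul_left
    · exact fun x _ => ((EuclideanSpace.proj (𝕜 := ℝ) j).comp A : 𝔼 →L[ℝ] ℝ).differentiable x
    · exact fun x _ => hd x
  simp only [h1]
  rw [integral_finsetSum]
  · simp only [h2, linTrace]
    rw [Finset.sum_neg_distrib, Finset.sum_mul]
  · intro j _
    exact ((hcA j).mul (hD j)).integrable_of_hasCompactSupport (hDc j).mul_left

/-- The real `L²` pairing of `a` and `b` with respect to the weight `W`. -/
noncomputable def pairing (W : 𝔼 → ℝ) (a b : 𝔼 → F) : ℝ := ∫ x, W x * inner ℝ (a x) (b x)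

theorem pairing_comm (W : 𝔼 → ℝ) (a b : 𝔼 → F) : pairing W a b = pairing W b a := by
  simp only [pairing, real_inner_comm]

/-- If `A` multiplies the weight by the constant `c`, then its adjoint with respect to the
weighted pairing is `-A - (c + tr A)`. -/
theorem pairing_linDeriv (A : 𝔼 →L[ℝ] 𝔼) {W : 𝔼 → ℝ} {a b : 𝔼 → F} {c : ℝ}
    (hW : ContDiffOn ℝ ∞ W {0}ᶜ) (ha : ContDiffOn ℝ ∞ a {0}ᶜ) (hb : ContDiffOn ℝ ∞ b {0}ᶜ)
    (h : IsTest W ∨ IsTest a) (hc : ∀ x ≠ 0, linDeriv A W x = c * W x) :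
    pairing W (linDeriv A a) b
      = -pairing W a (linDeriv A b) - (c + linTrace A) * pairing W a b := by
  have hA : IsTest W ∨ IsTest (linDeriv A a) := h.imp id fun h => h.linDeriv A
  have i0 := isTest_mul_inner hW ha hb h
  have i1 := (isTest_mul_inner hW (contDiffOn_linDeriv A ha) hb hA).integrable (μ := volume)
  have i2 := (isTest_mul_inner hW ha (contDiffOn_linDeriv A hb) h).integrable (μ := volume)
  have key := integral_linDeriv A i0
  have e : ∀ x, linDeriv A (fun y => W y * inner ℝ (a y) (b y)) x
      = c * (W x * inner ℝ (a x) (b x)) + W x * inner ℝ (linDeriv A a x) (b x)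
        + W x * inner ℝ (a x) (linDeriv A b x) := by
    intro x
    by_cases hx : x = 0
    · subst hx
      have hh : W 0 = 0 ∨ a 0 = 0 := h.imp (fun h => image_eq_zero_of_notMem_tsupport h.zero_notMem)
        fun h => image_eq_zero_of_notMem_tsupport h.zero_notMem
      rcases hh with hh | hh <;> simp [hh, linDeriv_zero_right]
    · rw [linDeriv_mul_inner A (differentiableAt_of_ne_zero hW hx)
        (differentiableAt_of_ne_zero ha hx) (differentiableAt_of_ne_zero hb hx), hc x hx]
      ring
  simp only [e] at key
  have i3 := (i0.integrable (μ := volume)).const_mul c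
  have i4 : Integrable (fun x => c * (W x * inner ℝ (a x) (b x))
    + W x * inner ℝ (linDeriv A a x) (b x)) volume := i3.add i1
  rw [integral_add i4 i2, integral_add i3 i1, integral_const_mul] at key
  simp only [pairing]
  linarith

end IntegrationByParts

/-! ### Infinitesimal rotations and the angular Laplacian -/

section AngularLaplacian

open Filter Topology

variable {n : ℕ} {F : Type*} [NormedAddCommGroup F] [InnerProductSpace ℝ F]

local notation "𝔼" => EuclideanSpace ℝ (Fin n)

/-- The generator `x ↦ xᵢ eⱼ - xⱼ eᵢ` of the rotations in the `(i, j)`-plane. -/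
noncomputable def rotGen (i j : Fin n) : 𝔼 →L[ℝ] 𝔼 :=
  (EuclideanSpace.proj (𝕜 := ℝ) i : 𝔼 →L[ℝ] ℝ).smulRight (EuclideanSpace.single j (1 : ℝ))
    - (EuclideanSpace.proj (𝕜 := ℝ) j : 𝔼 →L[ℝ] ℝ).smulRight (EuclideanSpace.single i (1 : ℝ))

theorem rotGen_apply (i j : Fin n) (x : 𝔼) :
    rotGen i j x = x i • EuclideanSpace.single j (1 : ℝ)
      - x j • EuclideanSpace.single i (1 : ℝ) := by
  simp [rotGen]

theorem inner_rotGen (i j : Fin n) (x : 𝔼) : inner ℝ x (rotGen i j x) = 0 := by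
  rw [rotGen_apply, inner_sub_right, inner_smul_right, inner_smul_right,
    EuclideanSpace.inner_single_right, EuclideanSpace.inner_single_right]
  simp [mul_comm]

theorem linTrace_rotGen (i j : Fin n) : linTrace (rotGen i j) = 0 := by
  simp only [linTrace, rotGen_apply, WithLp.ofLp_sub, WithLp.ofLp_smul, Pi.sub_apply,
    Pi.smul_apply, smul_eq_mul, PiLp.ofLp_single, Pi.single_apply]
  simp [Finset.sum_ite_eq, eq_comm]

theorem linTrace_id : linTrace (.id ℝ 𝔼) = n := by
  simp [linTrace]

theorem sum_rotGen_rotGen (x : 𝔼) :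
    ∑ i, ∑ j, rotGen i j (rotGen i j x) = (-(2 * ((n : ℝ) - 1))) • x := by
  ext k
  simp only [rotGen_apply]
  simp only [WithLp.ofLp_sum, WithLp.ofLp_sub, WithLp.ofLp_smul, Finset.sum_apply, Pi.sub_apply,
    Pi.smul_apply, smul_eq_mul, PiLp.ofLp_single, Pi.single_apply]
  simp only [mul_sub, mul_ite, mul_one, mul_zero,
    Finset.sum_sub_distrib, Finset.sum_ite_eq, Finset.mem_univ, if_true]
  simp [Finset.sum_ite_eq]
  ring

/-- The angular part `½ ∑ᵢⱼ (xᵢ ∂ⱼ - xⱼ ∂ᵢ)²` of the Laplacian, the extension of `Δ_S` to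
functions on `ℝⁿ \ {0}` acting on each sphere separately. -/
noncomputable def angLaplacian (f : 𝔼 → F) (x : 𝔼) : F :=
  (1 / 2 : ℝ) • ∑ i, ∑ j, linDeriv (rotGen i j) (linDeriv (rotGen i j) f) x

theorem euclidean_norm_sq (x : 𝔼) : ‖x‖ ^ 2 = ∑ i, x i ^ 2 := by
  rw [EuclideanSpace.norm_sq_eq]; simp

/-- The decomposition `r² Δ = (r ∂_r)² + (n - 2) r ∂_r + Δ_S`. -/
theorem norm_sq_smul_laplacian {f : 𝔼 → F} {x : 𝔼} (hf : ContDiffAt ℝ 2 f x) :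
    ‖x‖ ^ 2 • Laplacian.laplacian f x
      = linDeriv (.id ℝ 𝔼) (linDeriv (.id ℝ 𝔼) f) x
        + ((n : ℝ) - 2) • linDeriv (.id ℝ 𝔼) f x + angLaplacian f x := by
  have hL : Laplacian.laplacian f x = ∑ j : Fin n,
      fderiv ℝ (fderiv ℝ f) x (EuclideanSpace.single j 1) (EuclideanSpace.single j 1) := by
    rw [InnerProductSpace.laplacian_eq_iteratedFDeriv_orthonormalBasis f
      (EuclideanSpace.basisFun (Fin n) ℝ)]
    simp [iteratedFDeriv_two_apply]
  rw [hL]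
  simp only [angLaplacian, linDeriv_linDeriv _ _ hf]
  set B := fderiv ℝ (fderiv ℝ f) x with hB
  have hx2 : B x x = ∑ i, ∑ j,
      (x i * x j) • B (EuclideanSpace.single i 1) (EuclideanSpace.single j 1) := by
    conv_lhs => rw [← euclidean_sum_single x]
    simp only [map_sum, map_smul, _root_.sum_apply, _root_.smul_apply,
      Finset.smul_sum, smul_smul]
    rw [Finset.sum_comm]
    refine Finset.sum_congr rfl fun i _ => Finset.sum_congr rfl fun j _ => ?_
    rw [mul_comm]
  have h1 : ∑ i, ∑ j, B (rotGen i j x) (rotGen i j x)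
      = (2 * ‖x‖ ^ 2) • (∑ j : Fin n, B (EuclideanSpace.single j 1) (EuclideanSpace.single j 1))
        - (2 : ℝ) • B x x := by
    have : ∀ i j : Fin n, B (rotGen i j x) (rotGen i j x)
        = (x i ^ 2) • B (EuclideanSpace.single j 1) (EuclideanSpace.single j 1)
          + (x j ^ 2) • B (EuclideanSpace.single i 1) (EuclideanSpace.single i 1)
          - (x i * x j) • B (EuclideanSpace.single i 1) (EuclideanSpace.single j 1)
          - (x j * x i) • B (EuclideanSpace.single j 1) (EuclideanSpace.single i 1) := by
      intro i j
      simp only [rotGen_apply, map_sub, map_smul, _root_.sub_apply,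
        _root_.smul_apply]
      module
    simp only [this, Finset.sum_sub_distrib, Finset.sum_add_distrib]
    rw [← hx2, Finset.sum_comm (f := fun i j =>
      (x j * x i) • B (EuclideanSpace.single j 1) (EuclideanSpace.single i 1)), ← hx2]
    rw [euclidean_norm_sq]
    have e1 : ∑ i, ∑ j : Fin n,
        (x i ^ 2) • B (EuclideanSpace.single j 1) (EuclideanSpace.single j 1)
        = (∑ i, x i ^ 2) • ∑ j : Fin n,
          B (EuclideanSpace.single j 1) (EuclideanSpace.single j 1) := by
      simp only [← Finset.smul_sum, ← Finset.sum_smul]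
    rw [Finset.sum_comm (f := fun i j =>
      (x j ^ 2) • B (EuclideanSpace.single i 1) (EuclideanSpace.single i 1)), e1]
    module
  simp only [Finset.sum_add_distrib]
  rw [h1]
  simp only [← map_sum, sum_rotGen_rotGen]
  simp only [map_smul, linDeriv, ContinuousLinearMap.id_apply]
  module

/-- Lagrange's identity `r² |∇f|² = |r ∂_r f|² + ½ ∑ᵢⱼ |(xᵢ ∂ⱼ - xⱼ ∂ᵢ) f|²`. -/
theorem norm_sq_mul_gradSq (f : 𝔼 → ℂ) (x : 𝔼) :
    ‖x‖ ^ 2 * gradSq f x = ‖linDeriv (.id ℝ 𝔼) f x‖ ^ 2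
      + 1 / 2 * ∑ i, ∑ j, ‖linDeriv (rotGen i j) f x‖ ^ 2 := by
  simp only [linDeriv, gradSq, ContinuousLinearMap.id_apply]
  set L := fderiv ℝ f x
  set a : Fin n → ℂ := fun i => L (EuclideanSpace.single i 1) with ha
  have hx : ‖L x‖ ^ 2 = ∑ i, ∑ j, (x i * x j) * inner ℝ (a i) (a j) := by
    have : L x = ∑ i, x i • a i := by
      conv_lhs => rw [← euclidean_sum_single x]
      simp [ha]
    rw [this, ← real_inner_self_eq_norm_sq, sum_inner]
    refine Finset.sum_congr rfl fun i _ => ?_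
    rw [inner_sum]
    refine Finset.sum_congr rfl fun j _ => ?_
    rw [real_inner_smul_left, real_inner_smul_right]
    ring
  have h1 : ∀ i j, ‖L (rotGen i j x)‖ ^ 2 = x i ^ 2 * ‖a j‖ ^ 2 + x j ^ 2 * ‖a i‖ ^ 2
      - 2 * ((x i * x j) * inner ℝ (a i) (a j)) := by
    intro i j
    have : L (rotGen i j x) = x i • a j - x j • a i := by
      simp [rotGen_apply, ha]
    rw [this, norm_sub_sq_real, norm_smul, norm_smul, mul_pow, mul_pow, real_inner_smul_left,
      real_inner_smul_right, Real.norm_eq_abs, Real.norm_eq_abs, sq_abs, sq_abs,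
      real_inner_comm]
    ring
  simp only [h1, Finset.sum_sub_distrib, Finset.sum_add_distrib, ← Finset.mul_sum]
  rw [← hx, euclidean_norm_sq]
  simp only [← Finset.sum_mul, ← Finset.mul_sum]
  change _ * ∑ i, ‖a i‖ ^ 2 = _
  ring

theorem contDiffOn_angLaplacian {f : 𝔼 → F} (hf : ContDiffOn ℝ ∞ f {0}ᶜ) :
    ContDiffOn ℝ ∞ (angLaplacian f) {0}ᶜ :=
  contDiffOn_const.smul (ContDiffOn.sum fun _ _ => ContDiffOn.sum fun _ _ =>
    contDiffOn_linDeriv _ (contDiffOn_linDeriv _ hf))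

theorem IsTest.angLaplacian {f : 𝔼 → F} (hf : IsTest f) : IsTest (angLaplacian f) := by
  refine hf.of_support_subset (contDiffOn_angLaplacian hf.contDiffOn) fun x hx => ?_
  by_contra h
  refine hx ?_
  have h0 : f =ᶠ[𝓝 x] 0 := notMem_tsupport_iff_eventuallyEq.1 h
  have h1 : ∀ A : 𝔼 →L[ℝ] 𝔼, ∀ g : 𝔼 → F, g =ᶠ[𝓝 x] 0 → _root_.linDeriv A g =ᶠ[𝓝 x] 0 := by
    intro A g hg
    filter_upwards [hg.fderiv (𝕜 := ℝ)] with y hy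
    rw [_root_.linDeriv, hy]
    simp
  simp [_root_.angLaplacian, fun i j : Fin n =>
    (h1 (rotGen i j) _ (h1 (rotGen i j) f h0)).eq_of_nhds]

theorem angLaplacian_euler {f : 𝔼 → F} (hf : ContDiffOn ℝ ∞ f {0}ᶜ) {x : 𝔼} (hx : x ≠ 0) :
    angLaplacian (linDeriv (.id ℝ 𝔼) f) x = linDeriv (.id ℝ 𝔼) (angLaplacian f) x := by
  have h2 : ∀ {g : 𝔼 → F} {y : 𝔼}, ContDiffOn ℝ ∞ g {0}ᶜ → y ≠ 0 → ContDiffAt ℝ 2 g y :=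
    fun hg hy => (contDiffAt_of_ne_zero hg hy).of_le (by norm_cast)
  have h1 : ∀ i j : Fin n, linDeriv (rotGen i j) (linDeriv (rotGen i j) (linDeriv (.id ℝ 𝔼) f)) x
      = linDeriv (.id ℝ 𝔼) (linDeriv (rotGen i j) (linDeriv (rotGen i j) f)) x := by
    intro i j
    rw [← linDeriv_id_comm _ (h2 (contDiffOn_linDeriv _ hf) hx)]
    apply linDeriv_congr
    filter_upwards [isOpen_compl_singleton.mem_nhds hx] with y hy
    exact linDeriv_id_comm _ (h2 hf hy)
  simp only [angLaplacian, h1]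
  have hd : ∀ i j : Fin n,
      DifferentiableAt ℝ (linDeriv (rotGen i j) (linDeriv (rotGen i j) f)) x := fun i j =>
    differentiableAt_of_ne_zero (contDiffOn_linDeriv _ (contDiffOn_linDeriv _ hf)) hx
  conv_rhs => rw [linDeriv]
  change _ = fderiv ℝ (fun x => (1 / 2 : ℝ) • ∑ i, ∑ j,
    linDeriv (rotGen i j) (linDeriv (rotGen i j) f) x) x x
  rw [fderiv_fun_const_smul (DifferentiableAt.fun_sum fun i _ =>
    DifferentiableAt.fun_sum fun j _ => hd i j),
    fderiv_fun_sum fun i _ => DifferentiableAt.fun_sum fun j _ => hd i j]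
  simp only [fderiv_fun_sum fun j _ => hd _ j]
  simp [linDeriv]

/-- Green's formula for the angular Laplacian with respect to a radial weight. -/
theorem pairing_angLaplacian {W : 𝔼 → ℝ} {a b : 𝔼 → F}
    (hW : ContDiffOn ℝ ∞ W {0}ᶜ) (ha : ContDiffOn ℝ ∞ a {0}ᶜ) (hb : ContDiffOn ℝ ∞ b {0}ᶜ)
    (h : IsTest W ∨ IsTest a) (hr : ∀ i j, ∀ x ≠ 0, linDeriv (rotGen i j) W x = 0) :
    pairing W (angLaplacian a) b = -(1 / 2 *
      ∑ i, ∑ j, pairing W (linDeriv (rotGen i j) a) (linDeriv (rotGen i j) b)) := by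
  have h1 : ∀ i j : Fin n,
      pairing W (linDeriv (rotGen i j) (linDeriv (rotGen i j) a)) b
        = -pairing W (linDeriv (rotGen i j) a) (linDeriv (rotGen i j) b) := by
    intro i j
    rw [pairing_linDeriv (c := 0) _ hW (contDiffOn_linDeriv _ ha) hb (h.imp id (·.linDeriv _))
      (by simpa using hr i j), linTrace_rotGen]
    ring
  have h2 : pairing W (angLaplacian a) b = 1 / 2 * ∑ i, ∑ j,
      pairing W (linDeriv (rotGen i j) (linDeriv (rotGen i j) a)) b := by
    have hi : ∀ i j : Fin n, Integrable fun x => W x *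
        inner ℝ (linDeriv (rotGen i j) (linDeriv (rotGen i j) a) x) (b x) := fun i j =>
      (isTest_mul_inner hW (contDiffOn_linDeriv _ (contDiffOn_linDeriv _ ha)) hb
        (h.imp id fun h => (h.linDeriv _).linDeriv _)).integrable
    simp only [pairing, angLaplacian, real_inner_smul_left, sum_inner, mul_left_comm (W _) (1 / 2),
      Finset.mul_sum]
    rw [integral_finsetSum _ fun i _ => integrable_finsetSum _ fun j _ => (hi i j).const_mul _]
    refine Finset.sum_congr rfl fun i _ => ?_
    rw [integral_finsetSum _ fun j _ => (hi i j).const_mul _]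
    refine Finset.sum_congr rfl fun j _ => ?_
    rw [integral_const_mul]
  simp only [h2, h1, Finset.sum_neg_distrib]
  ring

/-- The angular Laplacian is symmetric with respect to a radial weight. -/
theorem pairing_angLaplacian_symm {W : 𝔼 → ℝ} {a b : 𝔼 → F}
    (hW : ContDiffOn ℝ ∞ W {0}ᶜ) (ha : ContDiffOn ℝ ∞ a {0}ᶜ) (hb : ContDiffOn ℝ ∞ b {0}ᶜ)
    (h : IsTest W ∨ (IsTest a ∧ IsTest b)) (hr : ∀ i j, ∀ x ≠ 0, linDeriv (rotGen i j) W x = 0) :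
    pairing W (angLaplacian a) b = pairing W a (angLaplacian b) := by
  rw [pairing_angLaplacian hW ha hb (h.imp id And.left) hr, pairing_comm W a,
    pairing_angLaplacian hW hb ha (h.imp id And.right) hr]
  simp only [pairing_comm W (linDeriv _ a)]

/-- The chain rule for the composition with the radial retraction `ρ y = r y / |y|`. -/
theorem linDeriv_comp_retraction (A : 𝔼 →L[ℝ] 𝔼) {f : 𝔼 → F} (r : ℝ) {x : 𝔼} (hx : x ≠ 0)
    (hf : DifferentiableAt ℝ f ((r * ‖x‖ ^ (-1 : ℝ)) • x)) :
    linDeriv A (fun y => f ((r * ‖y‖ ^ (-1 : ℝ)) • y)) x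
      = fderiv ℝ f ((r * ‖x‖ ^ (-1 : ℝ)) • x) ((r * ‖x‖ ^ (-1 : ℝ)) • A x
        - (r * ‖x‖ ^ (-3 : ℝ) * inner ℝ x (A x)) • x) := by
  have h1 : DifferentiableAt ℝ (fun y : 𝔼 => ‖y‖ ^ (-1 : ℝ)) x :=
    differentiableAt_of_ne_zero (contDiffOn_norm_rpow (-1)) hx
  have h2 : HasFDerivAt (fun y : 𝔼 => (r * ‖y‖ ^ (-1 : ℝ)) • y)
      ((r * ‖x‖ ^ (-1 : ℝ)) • ContinuousLinearMap.id ℝ 𝔼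
        + (r • fderiv ℝ (fun y : 𝔼 => ‖y‖ ^ (-1 : ℝ)) x).smulRight x) x :=
    (h1.hasFDerivAt.const_mul r).smul (hasFDerivAt_id x)
  have h3 := (HasFDerivAt.comp (f := fun y : 𝔼 => (r * ‖y‖ ^ (-1 : ℝ)) • y) x
    hf.hasFDerivAt h2).fderiv
  change fderiv ℝ (f ∘ fun y : 𝔼 => (r * ‖y‖ ^ (-1 : ℝ)) • y) x (A x) = _
  rw [h3]
  have h4 : fderiv ℝ (fun y : 𝔼 => ‖y‖ ^ (-1 : ℝ)) x (A x)
      = -1 * ‖x‖ ^ (-3 : ℝ) * inner ℝ x (A x) := by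
    have := linDeriv_norm_rpow A (-1) hx
    rw [linDeriv] at this
    rw [this]; norm_num
  simp only [ContinuousLinearMap.comp_apply, _root_.add_apply,
    _root_.smul_apply, ContinuousLinearMap.smulRight_apply,
    ContinuousLinearMap.id_apply, h4]
  congr 1
  rw [smul_eq_mul]
  module

theorem retraction_ne_zero {r : ℝ} (hr : 0 < r) {x : 𝔼} (hx : x ≠ 0) :
    (r * ‖x‖ ^ (-1 : ℝ)) • x ≠ 0 :=
  smul_ne_zero (mul_pos hr (Real.rpow_pos_of_pos (norm_pos_iff.2 hx) _)).ne' hx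

theorem contDiffOn_comp_retraction {f : 𝔼 → F} (hf : ContDiffOn ℝ ∞ f {0}ᶜ) {r : ℝ}
    (hr : 0 < r) : ContDiffOn ℝ ∞ (fun y : 𝔼 => f ((r * ‖y‖ ^ (-1 : ℝ)) • y)) {0}ᶜ :=
  hf.comp ((contDiffOn_const.mul (contDiffOn_norm_rpow _)).smul contDiffOn_id)
    fun _ hx => retraction_ne_zero hr hx

/-- The extension of a function on a sphere which is constant along rays is annihilated by the
Euler operator and its Laplacian is `r⁻² Δ_S`. -/
theorem laplacian_comp_retraction {f : 𝔼 → F} (hf : ContDiffOn ℝ ∞ f {0}ᶜ) {r : ℝ}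
    (hr : 0 < r) {x : 𝔼} (hx : x ≠ 0) :
    ‖x‖ ^ 2 • Laplacian.laplacian (fun y : 𝔼 => f ((r * ‖y‖ ^ (-1 : ℝ)) • y)) x
      = angLaplacian f ((r * ‖x‖ ^ (-1 : ℝ)) • x) := by
  have hE : ∀ y : 𝔼, y ≠ 0 →
      linDeriv (.id ℝ 𝔼) (fun y : 𝔼 => f ((r * ‖y‖ ^ (-1 : ℝ)) • y)) y = 0 := by
    intro y hy
    rw [linDeriv_comp_retraction _ r hy (differentiableAt_of_ne_zero hf (retraction_ne_zero hr hy))]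
    have : ‖y‖ ^ (-3 : ℝ) * ‖y‖ ^ 2 = ‖y‖ ^ (-1 : ℝ) := by
      rw [← Real.rpow_natCast, ← Real.rpow_add (norm_pos_iff.2 hy)]
      norm_num
    rw [ContinuousLinearMap.id_apply, real_inner_self_eq_norm_sq, mul_assoc, this, sub_self,
      map_zero]
  have hR : ∀ (i j : Fin n) {g : 𝔼 → F}, ContDiffOn ℝ ∞ g {0}ᶜ → ∀ y : 𝔼, y ≠ 0 →
      linDeriv (rotGen i j) (fun y : 𝔼 => g ((r * ‖y‖ ^ (-1 : ℝ)) • y)) y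
        = linDeriv (rotGen i j) g ((r * ‖y‖ ^ (-1 : ℝ)) • y) := by
    intro i j g hg y hy
    rw [linDeriv_comp_retraction _ r hy (differentiableAt_of_ne_zero hg (retraction_ne_zero hr hy)),
      inner_rotGen, linDeriv]
    simp
  have hnhds : ∀ᶠ y in 𝓝 x, y ≠ 0 := isOpen_compl_singleton.mem_nhds hx
  rw [norm_sq_smul_laplacian ((contDiffAt_of_ne_zero (contDiffOn_comp_retraction hf hr) hx).of_le
    (by norm_cast)), hE x hx]
  have hEE : linDeriv (.id ℝ 𝔼) (linDeriv (.id ℝ 𝔼)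
      (fun y : 𝔼 => f ((r * ‖y‖ ^ (-1 : ℝ)) • y))) x = 0 := by
    rw [linDeriv_congr _ (g := fun _ => (0 : F)) (hnhds.mono fun y hy => hE y hy)]
    simp [linDeriv]
  rw [hEE, smul_zero, add_zero, zero_add]
  simp only [angLaplacian]
  congr 1
  refine Finset.sum_congr rfl fun i _ => Finset.sum_congr rfl fun j _ => ?_
  rw [linDeriv_congr _ (hnhds.mono fun y hy => hR i j hf y hy),
    hR i j (contDiffOn_linDeriv _ hf) x hx]

/-- On `ℝⁿ \ {0}`, extending `f (r, ·)` from the sphere is composing `f` with the retraction. -/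
theorem homExt_polar (f : 𝔼 → ℂ) (r : ℝ) {x : 𝔼} (hx : x ≠ 0) :
    homExt (polar f r) x = f ((r * ‖x‖ ^ (-1 : ℝ)) • x) := by
  rw [homExt, dif_neg hx, polar, smul_smul, Real.rpow_neg_one]

theorem sphereSmooth_polar {f : 𝔼 → ℂ} (hf : ContDiffOn ℝ ∞ f {0}ᶜ) {r : ℝ} (hr : 0 < r) :
    SphereSmooth (polar f r) :=
  (contDiffOn_comp_retraction hf hr).congr fun _ hx => homExt_polar f r hx

theorem USphere.ne_zero (θ : USphere n) : (θ : 𝔼) ≠ 0 :=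
  ne_zero_of_mem_unit_sphere θ

/-- The Laplace-Beltrami operator applied in the angular variable. -/
theorem sphereLaplacian_polar {f : 𝔼 → ℂ} (hf : ContDiffOn ℝ ∞ f {0}ᶜ) {r : ℝ} (hr : 0 < r)
    (θ : USphere n) : sphereLaplacian (polar f r) θ = angLaplacian f (r • (θ : 𝔼)) := by
  have hθ : ‖(θ : 𝔼)‖ = 1 := mem_sphere_zero_iff_norm.1 θ.2
  have h := laplacian_comp_retraction hf hr (USphere.ne_zero θ)
  rw [hθ] at h
  simp only [one_pow, one_smul, Real.one_rpow, mul_one] at h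
  rw [sphereLaplacian, ← h]
  refine InnerProductSpace.laplacian_congr_nhds ?_ |>.eq_of_nhds
  filter_upwards [isOpen_compl_singleton.mem_nhds (USphere.ne_zero θ)] with y hy
  exact homExt_polar f r hy

theorem polar_homExt (u : USphere n → ℂ) {r : ℝ} (hr : 0 < r) : polar (homExt u) r = u := by
  funext θ
  have hθ : ‖(θ : 𝔼)‖ = 1 := mem_sphere_zero_iff_norm.1 θ.2
  rw [polar, homExt, dif_neg (smul_ne_zero hr.ne' (USphere.ne_zero θ))]
  congr 1
  ext1
  simp [norm_smul, hθ, abs_of_pos hr, smul_smul, hr.ne']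

theorem angLaplacian_homExt {u : USphere n → ℂ} (hu : SphereSmooth u) {r : ℝ} (hr : 0 < r)
    (θ : USphere n) : angLaplacian (homExt u) (r • (θ : 𝔼)) = sphereLaplacian u θ := by
  rw [← sphereLaplacian_polar hu hr, polar_homExt u hr]

end AngularLaplacian

/-! ### Integration in polar coordinates -/

section PolarCoordinates

variable {n : ℕ}

local notation "𝔼" => EuclideanSpace ℝ (Fin n)

theorem integrableOn_and_integral_polar (hn : 0 < n) {h : 𝔼 → ℝ} (hh : Integrable h) :
    IntegrableOn (fun r : ℝ => (∫ θ : USphere n, h (r • (θ : 𝔼)) ∂sphereMeasure n) * r ^ (n - 1))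
      (Ioi 0) ∧
    ∫ r in Ioi (0 : ℝ), (∫ θ : USphere n, h (r • (θ : 𝔼)) ∂sphereMeasure n) * r ^ (n - 1)
      = ∫ x, h x := by
  have : Nonempty (Fin n) := ⟨⟨0, hn⟩⟩
  have hdim : Module.finrank ℝ 𝔼 = n := finrank_euclideanSpace_fin
  have hmp := (volume : Measure 𝔼).measurePreserving_homeomorphUnitSphereProd
  rw [hdim] at hmp
  have hemb := (homeomorphUnitSphereProd 𝔼).measurableEmbedding
  set g : USphere n × Ioi (0 : ℝ) → ℝ := fun p => h ((p.2 : ℝ) • (p.1 : 𝔼)) with hg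
  have hcomp : g ∘ homeomorphUnitSphereProd 𝔼 = h ∘ Subtype.val := by
    funext x
    have hx : ‖(x : 𝔼)‖ ≠ 0 := norm_ne_zero_iff.2 x.2
    simp [hg, smul_smul, hx]
  have hI : Integrable g ((sphereMeasure n).prod (Measure.volumeIoiPow (n - 1))) := by
    rw [← hmp.integrable_comp_emb hemb, hcomp, ← integrableOn_iff_comap_subtypeVal (by measurability),
      IntegrableOn, restrict_compl_singleton]
    exact hh
  have hint : ∫ p, g p ∂((sphereMeasure n).prod (Measure.volumeIoiPow (n - 1))) = ∫ x, h x := by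
    rw [← hmp.integral_comp hemb g]
    change ∫ x, (g ∘ homeomorphUnitSphereProd 𝔼) x ∂_ = _
    rw [hcomp]
    change ∫ x : ({0}ᶜ : Set 𝔼), h x ∂_ = _
    rw [integral_subtype_comap (measurableSet_singleton _).compl fun x => h x,
      restrict_compl_singleton]
  have hI2 := hI.integral_prod_right
  rw [Measure.volumeIoiPow, integrable_withDensity_iff_integrable_smul' (by fun_prop)
    (by simp)] at hI2
  have e : ∀ r : Ioi (0 : ℝ), (ENNReal.ofReal ((r : ℝ) ^ (n - 1))).toReal •
      (∫ θ, g (θ, r) ∂sphereMeasure n) = (fun r : ℝ =>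
      (∫ θ : USphere n, h (r • (θ : 𝔼)) ∂sphereMeasure n) * r ^ (n - 1)) r := by
    intro r
    rw [ENNReal.toReal_ofReal (pow_nonneg (le_of_lt r.2) _), smul_eq_mul, mul_comm]
  constructor
  · rw [integrableOn_iff_comap_subtypeVal measurableSet_Ioi]
    exact hI2.congr (.of_forall e)
  · rw [← hint, integral_prod_symm _ hI]
    rw [← integral_subtype_comap measurableSet_Ioi (fun r : ℝ =>
      (∫ θ : USphere n, h (r • (θ : 𝔼)) ∂sphereMeasure n) * r ^ (n - 1))]
    rw [Measure.volumeIoiPow, integral_withDensity_eq_integral_toReal_smul (by fun_prop) (by simp)]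
    exact integral_congr_ae (.of_forall fun r => (e r).symm)

end PolarCoordinates

/-! ### Green's formula on the sphere -/

section SphereGreen

open Filter Topology

variable {n : ℕ}

local notation "𝔼" => EuclideanSpace ℝ (Fin n)

theorem SphereSmooth.continuous {u : USphere n → ℂ} (hu : SphereSmooth u) : Continuous u := by
  have h1 : ContinuousOn (homExt u) {0}ᶜ := ContDiffOn.continuousOn hu
  have h2 : Continuous fun θ : USphere n => homExt u (θ : 𝔼) :=
    h1.comp_continuous continuous_subtype_val fun θ => USphere.ne_zero θ
  have h3 := polar_homExt u one_pos
  have h4 : (fun θ : USphere n => homExt u (θ : 𝔼)) = u := by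
    rw [← h3]
    funext θ
    conv_rhs => rw [polar, one_smul]
    rw [h3]
  rwa [h4] at h2

theorem SphereSmooth.continuous_sphereLaplacian {u : USphere n → ℂ} (hu : SphereSmooth u) :
    Continuous (sphereLaplacian u) := by
  have h2 : Continuous fun θ : USphere n => angLaplacian (homExt u) (θ : 𝔼) :=
    (contDiffOn_angLaplacian hu).continuousOn.comp_continuous continuous_subtype_val
      fun θ => USphere.ne_zero θ
  refine h2.congr fun θ => ?_
  simpa using angLaplacian_homExt hu one_pos θ

theorem Continuous.memLp_sphere {u : USphere n → ℂ} (hu : Continuous u) :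
    MemLp u 2 (sphereMeasure n) :=
  hu.memLp_of_hasCompactSupport (HasCompactSupport.of_compactSpace u)

theorem coeFn_toSphereL2 {u : USphere n → ℂ} (hu : Continuous u) :
    toSphereL2 u =ᵐ[sphereMeasure n] u := by
  rw [toSphereL2, dif_pos hu.memLp_sphere]
  exact hu.memLp_sphere.coeFn_toLp

/-- There is a radial weight in `C_c^∞(ℝⁿ \ {0})` with positive integral. -/
theorem exists_radial_weight (hn : 0 < n) : ∃ ψ : ℝ → ℝ, ContDiff ℝ ∞ ψ ∧
    IsTest (fun x : 𝔼 => ψ (‖x‖ ^ 2)) ∧ (∀ t, 0 ≤ ψ t) ∧ 0 < ∫ x : 𝔼, ψ (‖x‖ ^ 2) := by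
  let b : ContDiffBump (1 : ℝ) := ⟨1 / 4, 1 / 2, by norm_num, by norm_num⟩
  have hsm : ContDiff ℝ ∞ fun x : 𝔼 => b (‖x‖ ^ 2) := b.contDiff.comp (contDiff_norm_sq ℝ)
  have hsub : tsupport (fun x : 𝔼 => b (‖x‖ ^ 2)) ⊆
      {x : 𝔼 | ‖x‖ ^ 2 ∈ Metric.closedBall (1 : ℝ) (1 / 2)} := by
    refine closure_minimal (fun x hx => ?_)
      (Metric.isClosed_closedBall.preimage (by fun_prop : Continuous fun x : 𝔼 => ‖x‖ ^ 2))
    have : ‖x‖ ^ 2 ∈ Function.support b := hx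
    rw [b.support_eq] at this
    exact Metric.ball_subset_closedBall this
  have hcs : HasCompactSupport fun x : 𝔼 => b (‖x‖ ^ 2) := by
    refine (isCompact_closedBall (0 : 𝔼) 2).of_isClosed_subset (isClosed_tsupport _)
      fun x hx => ?_
    have := hsub hx
    rw [mem_ofPred_eq, Metric.mem_closedBall, Real.dist_eq, abs_le] at this
    rw [mem_closedBall_zero_iff]
    nlinarith [norm_nonneg x]
  refine ⟨b, b.contDiff, ⟨hsm, hcs, fun h0 => ?_⟩, fun t => b.nonneg, ?_⟩
  · have := hsub h0
    rw [mem_ofPred_eq, Metric.mem_closedBall, Real.dist_eq, abs_le] at this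
    norm_num at this
  · refine hsm.continuous.integral_pos_of_hasCompactSupport_nonneg_nonzero hcs
      (fun x => b.nonneg) (x := EuclideanSpace.single ⟨0, hn⟩ (1 : ℝ)) ?_
    have : b 1 = 1 := b.one_of_mem_closedBall (by simp [b.rIn_pos.le])
    simp [this]

/-- Against a suitable radial weight, the integral over `ℝⁿ` of a function which is constant along
rays is a positive multiple of its integral over the sphere. -/
theorem exists_integral_radial_mul (hn : 0 < n) : ∃ (W : 𝔼 → ℝ) (c : ℝ), IsTest W ∧ 0 < c ∧
    (∀ x, 0 ≤ W x) ∧ (∀ i j, ∀ x, linDeriv (rotGen i j) W x = 0) ∧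
    ∀ (k : 𝔼 → ℝ) (q : USphere n → ℝ), ContDiffOn ℝ ∞ k {0}ᶜ →
      (∀ r : ℝ, 0 < r → ∀ θ : USphere n, k (r • (θ : 𝔼)) = q θ) →
      ∫ x, W x * k x = c * ∫ θ, q θ ∂sphereMeasure n := by
  obtain ⟨ψ, hψ, hT, hpos, hint⟩ := exists_radial_weight hn
  have hmain : ∀ (k : 𝔼 → ℝ) (q : USphere n → ℝ), ContDiffOn ℝ ∞ k {0}ᶜ →
      (∀ r : ℝ, 0 < r → ∀ θ : USphere n, k (r • (θ : 𝔼)) = q θ) →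
      ∫ x, ψ (‖x‖ ^ 2) * k x
        = (∫ r in Ioi (0 : ℝ), ψ (r ^ 2) * r ^ (n - 1)) * ∫ θ, q θ ∂sphereMeasure n := by
    intro k q hk hq
    have hI : Integrable fun x : 𝔼 => ψ (‖x‖ ^ 2) * k x := by
      refine IsTest.integrable (hT.of_support_subset (hT.contDiffOn.mul hk) fun x hx =>
        subset_tsupport _ fun h0 => hx ?_)
      simp [h0]
    rw [← (integrableOn_and_integral_polar hn hI).2, ← integral_mul_const]
    refine setIntegral_congr_fun measurableSet_Ioi fun r hr => ?_
    have : ∀ θ : USphere n, ψ (‖r • (θ : 𝔼)‖ ^ 2) * k (r • (θ : 𝔼)) = ψ (r ^ 2) * q θ := by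
      intro θ
      have hθ : ‖(θ : 𝔼)‖ = 1 := mem_sphere_zero_iff_norm.1 θ.2
      rw [hq r hr, norm_smul, hθ, mul_one, Real.norm_eq_abs, sq_abs]
    simp only [this, integral_const_mul]
    ring
  refine ⟨_, ∫ r in Ioi (0 : ℝ), ψ (r ^ 2) * r ^ (n - 1), hT, ?_, fun x => hpos _, ?_, hmain⟩
  · have h0 : 0 ≤ ∫ r in Ioi (0 : ℝ), ψ (r ^ 2) * r ^ (n - 1) :=
      setIntegral_nonneg measurableSet_Ioi fun r hr =>
        mul_nonneg (hpos _) (pow_nonneg (le_of_lt hr) _)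
    refine lt_of_le_of_ne h0 fun h => ?_
    have := hmain (fun _ => 1) (fun _ => 1) contDiffOn_const (fun _ _ _ => rfl)
    rw [← h, zero_mul] at this
    simp only [mul_one] at this
    linarith
  · intro i j x
    rw [linDeriv_radial _ (hψ.differentiable (by simp) _).hasDerivAt, inner_rotGen]
    ring

theorem integral_inner_sphereLaplacian_symm (hn : 0 < n) {u v : USphere n → ℂ}
    (hu : SphereSmooth u) (hv : SphereSmooth v) :
    ∫ θ, inner ℝ (sphereLaplacian u θ) (v θ) ∂sphereMeasure n
      = ∫ θ, inner ℝ (u θ) (sphereLaplacian v θ) ∂sphereMeasure n := by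
  obtain ⟨W, c, hW, hc, -, hrot, hk⟩ := exists_integral_radial_mul hn
  have h1 := pairing_angLaplacian_symm hW.contDiffOn hu hv (Or.inl hW) fun i j x _ => hrot i j x
  simp only [pairing] at h1
  rw [hk _ (fun θ => inner ℝ (sphereLaplacian u θ) (v θ))
    ((contDiffOn_angLaplacian hu).inner ℝ hv) fun r hr θ => ?_,
    hk _ (fun θ => inner ℝ (u θ) (sphereLaplacian v θ))
      (ContDiffOn.inner ℝ hu (contDiffOn_angLaplacian hv)) fun r hr θ => ?_] at h1
  · exact mul_left_cancel₀ hc.ne' h1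
  · rw [angLaplacian_homExt hv hr, ← congrFun (polar_homExt u hr) θ, polar]
  · rw [angLaplacian_homExt hu hr, ← congrFun (polar_homExt v hr) θ, polar]

theorem integral_inner_sphereLaplacian_nonpos (hn : 0 < n) {u : USphere n → ℂ}
    (hu : SphereSmooth u) : ∫ θ, inner ℝ (sphereLaplacian u θ) (u θ) ∂sphereMeasure n ≤ 0 := by
  obtain ⟨W, c, hW, hc, hpos, hrot, hk⟩ := exists_integral_radial_mul hn
  have h1 := pairing_angLaplacian hW.contDiffOn hu hu (Or.inl hW) fun i j x _ => hrot i j x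
  have h2 : 0 ≤ ∑ i, ∑ j, pairing W (linDeriv (rotGen i j) (homExt u))
      (linDeriv (rotGen i j) (homExt u)) :=
    Finset.sum_nonneg fun i _ => Finset.sum_nonneg fun j _ =>
      integral_nonneg fun x => mul_nonneg (hpos x) real_inner_self_nonneg
  rw [pairing, hk _ (fun θ => inner ℝ (sphereLaplacian u θ) (u θ))
    ((contDiffOn_angLaplacian hu).inner ℝ hu) fun r hr θ => ?_] at h1
  · nlinarith
  · rw [angLaplacian_homExt hu hr, ← congrFun (polar_homExt u hr) θ, polar]

end SphereGreen

/-! ### The graph of the Laplace-Beltrami operator -/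

section Graph

open Filter Topology

variable {n : ℕ}

local notation "𝔼" => EuclideanSpace ℝ (Fin n)

theorem homExt_add (u v : USphere n → ℂ) : homExt (u + v) = homExt u + homExt v := by
  funext x
  by_cases hx : x = 0 <;> simp [homExt, hx]

theorem homExt_smul (c : ℂ) (u : USphere n → ℂ) : homExt (c • u) = c • homExt u := by
  funext x
  by_cases hx : x = 0 <;> simp [homExt, hx]

theorem contDiffAt_homExt {u : USphere n → ℂ} (hu : SphereSmooth u) (θ : USphere n) :
    ContDiffAt ℝ 2 (homExt u) (θ : 𝔼) :=
  (contDiffAt_of_ne_zero hu (USphere.ne_zero θ)).of_le (by norm_cast)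

/-- The pairs `(u, -Δ_S u)` with smooth `u` form a linear subspace. -/
theorem exists_of_mem_span {p : SphereL2 n × SphereL2 n}
    (hp : p ∈ Submodule.span ℂ {p : SphereL2 n × SphereL2 n | ∃ u : USphere n → ℂ,
      SphereSmooth u ∧ p.1 =ᵐ[sphereMeasure n] u ∧
      p.2 =ᵐ[sphereMeasure n] fun θ => -sphereLaplacian u θ}) :
    ∃ u : USphere n → ℂ, SphereSmooth u ∧ p.1 =ᵐ[sphereMeasure n] u ∧
      p.2 =ᵐ[sphereMeasure n] fun θ => -sphereLaplacian u θ := by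
  induction hp using Submodule.span_induction with
  | mem p h => exact h
  | zero =>
    refine ⟨0, ?_, Lp.coeFn_zero _ _ _, ?_⟩
    · exact contDiffOn_const.congr fun x hx => by
        rw [homExt, dif_neg (by simpa using hx)]; rfl
    · refine (Lp.coeFn_zero _ _ _).trans (.of_forall fun θ => ?_)
      have : homExt (0 : USphere n → ℂ) = fun _ => 0 := by
        funext x
        by_cases hx : x = 0 <;> simp [homExt, hx]
      simp [sphereLaplacian, this]
  | add p q _ _ hp hq =>
    obtain ⟨u, hu, hu1, hu2⟩ := hp
    obtain ⟨v, hv, hv1, hv2⟩ := hq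
    refine ⟨u + v, ?_, (Lp.coeFn_add _ _).trans (hu1.add hv1),
      (Lp.coeFn_add _ _).trans ((hu2.add hv2).trans (.of_forall fun θ => ?_))⟩
    · rw [SphereSmooth, homExt_add]
      exact ContDiffOn.add hu hv
    · simp only [sphereLaplacian, homExt_add, Pi.add_apply]
      rw [ContDiffAt.laplacian_add (contDiffAt_homExt hu θ) (contDiffAt_homExt hv θ)]
      ring
  | smul c p _ hp =>
    obtain ⟨u, hu, hu1, hu2⟩ := hp
    refine ⟨c • u, ?_, (Lp.coeFn_smul _ _).trans (hu1.const_smul c),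
      (Lp.coeFn_smul _ _).trans ((hu2.const_smul c).trans (.of_forall fun θ => ?_))⟩
    · rw [SphereSmooth, homExt_smul]
      exact ContDiffOn.const_smul c hu
    · simp only [sphereLaplacian, homExt_smul, Pi.smul_apply]
      rw [InnerProductSpace.laplacian_smul c (contDiffAt_homExt hu θ)]
      simp

theorem mem_negLaplacianGraph {u : USphere n → ℂ} (hu : SphereSmooth u) :
    (toSphereL2 u, toSphereL2 fun θ => -sphereLaplacian u θ) ∈ negLaplacianGraph n :=
  Submodule.le_topologicalClosure _ (Submodule.subset_span ⟨u, hu, coeFn_toSphereL2 hu.continuous,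
    coeFn_toSphereL2 hu.continuous_sphereLaplacian.neg⟩)

theorem re_inner_sphereL2 {p q : SphereL2 n} {u v : USphere n → ℂ}
    (hp : p =ᵐ[sphereMeasure n] u) (hq : q =ᵐ[sphereMeasure n] v) :
    (inner ℂ p q).re = ∫ θ, inner ℝ (u θ) (v θ) ∂sphereMeasure n := by
  rw [L2.inner_def]
  have := integral_re (𝕜 := ℂ) (f := fun θ => inner ℂ (p θ) (q θ))
    (L2.integrable_inner (𝕜 := ℂ) p q)
  change RCLike.re (K := ℂ) _ = _
  rw [← this]
  refine integral_congr_ae ?_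
  filter_upwards [hp, hq] with θ h1 h2
  rw [h1, h2, Complex.inner]
  simp [mul_comm]

theorem re_inner_graph_symm (hn : 0 < n) {p q : SphereL2 n × SphereL2 n}
    (hp : p ∈ negLaplacianGraph n) (hq : q ∈ negLaplacianGraph n) :
    (inner ℂ p.2 q.1).re = (inner ℂ p.1 q.2).re := by
  have hq' : q ∈ closure _ := hq
  refine closure_minimal (t := {q : SphereL2 n × SphereL2 n |
    (inner ℂ p.2 q.1).re = (inner ℂ p.1 q.2).re}) (fun q hq => ?_)
    (isClosed_eq (by fun_prop) (by fun_prop)) hq'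
  have hp' : p ∈ closure _ := hp
  refine closure_minimal (t := {p : SphereL2 n × SphereL2 n |
    (inner ℂ p.2 q.1).re = (inner ℂ p.1 q.2).re}) (fun p hp => ?_)
    (isClosed_eq (by fun_prop) (by fun_prop)) hp'
  obtain ⟨u, hu, hu1, hu2⟩ := exists_of_mem_span hp
  obtain ⟨v, hv, hv1, hv2⟩ := exists_of_mem_span hq
  rw [mem_ofPred_eq, re_inner_sphereL2 hu2 hv1, re_inner_sphereL2 hu1 hv2]
  simp only [inner_neg_left, inner_neg_right, integral_neg,
    integral_inner_sphereLaplacian_symm hn hu hv]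

/-- The closure of `-Δ_S` is a symmetric operator. -/
theorem inner_graph_symm (hn : 0 < n) {p q : SphereL2 n × SphereL2 n}
    (hp : p ∈ negLaplacianGraph n) (hq : q ∈ negLaplacianGraph n) :
    inner ℂ p.2 q.1 = inner ℂ p.1 q.2 := by
  refine Complex.ext (re_inner_graph_symm hn hp hq) ?_
  have := re_inner_graph_symm hn hp ((negLaplacianGraph n).smul_mem Complex.I hq)
  simp only [Prod.smul_fst, Prod.smul_snd, inner_smul_right, Complex.mul_re, Complex.I_re,
    Complex.I_im] at this
  linarith

/-- The closure of `-Δ_S` is a nonnegative operator. -/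
theorem re_inner_graph_nonneg (hn : 0 < n) {p : SphereL2 n × SphereL2 n}
    (hp : p ∈ negLaplacianGraph n) : 0 ≤ (inner ℂ p.2 p.1).re := by
  have hp' : p ∈ closure _ := hp
  refine closure_minimal (t := {p : SphereL2 n × SphereL2 n | 0 ≤ (inner ℂ p.2 p.1).re})
    (fun p hp => ?_) (isClosed_le (by fun_prop) (by fun_prop)) hp'
  obtain ⟨u, hu, hu1, hu2⟩ := exists_of_mem_span hp
  rw [mem_ofPred_eq, re_inner_sphereL2 hu2 hu1]
  simp only [inner_neg_left, integral_neg]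
  linarith [integral_inner_sphereLaplacian_nonpos hn hu]

end Graph

/-! ### Symmetric operators with a total family of eigenvectors -/

section AbstractSpectral

open Filter Topology

variable {H : Type*} [NormedAddCommGroup H] [InnerProductSpace ℂ H]

theorem hasSum_starProjection [CompleteSpace H] {ι : Type*} {V : ι → Submodule ℂ H}
    [∀ i, CompleteSpace (V i)] (hV : OrthogonalFamily ℂ (fun i => V i) fun i => (V i).subtypeₗᵢ)
    (htot : ⊤ ≤ (⨆ i, V i).topologicalClosure) (u : H) :
    HasSum (fun i => (V i).starProjection u) u := by
  classical
  have hS := IsHilbertSum.mkInternal _ hV htot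
  have h1 := hS.hasSum_linearIsometryEquiv_symm (hS.linearIsometryEquiv u)
  rw [LinearIsometryEquiv.symm_apply_apply] at h1
  set w := hS.linearIsometryEquiv u
  have h2 : ∀ i, (V i).starProjection u = (w i : H) := by
    intro i
    have h3 := h1.mapL (V i).starProjection
    have h4 : ∀ j, (V i).starProjection ((V j).subtypeₗᵢ (w j))
        = if j = i then (w i : H) else 0 := by
      intro j
      split_ifs with h
      · subst h
        exact Submodule.starProjection_eq_self_iff.2 (w j).2
      · refine (Submodule.starProjection_apply_eq_zero_iff _).2 ?_
        rw [Submodule.mem_orthogonal]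
        intro y hy
        exact hV (Ne.symm h) ⟨y, hy⟩ (w j)
    simp only [h4] at h3
    exact h3.unique (hasSum_ite_eq i _)
  simp only [h2]
  exact h1

variable {G : Submodule ℂ (H × H)} {V : ℝ → Submodule ℂ H}

theorem orthogonalFamily_eigenspaces (hV : ∀ μ u, u ∈ V μ ↔ (u, (μ : ℂ) • u) ∈ G)
    (hsymm : ∀ p ∈ G, ∀ q ∈ G, inner ℂ p.2 q.1 = inner ℂ p.1 q.2) :
    OrthogonalFamily ℂ (fun μ => V μ) fun μ => (V μ).subtypeₗᵢ := by
  intro μ ν hμν u v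
  have h := hsymm _ ((hV μ u).1 u.2) _ ((hV ν v).1 v.2)
  simp only [inner_smul_left, inner_smul_right, Complex.conj_ofReal] at h
  have h2 : ((μ - ν : ℝ) : ℂ) * inner ℂ (u : H) (v : H) = 0 := by
    push_cast
    linear_combination h
  rcases mul_eq_zero.1 h2 with h3 | h3
  · exact absurd (sub_eq_zero.1 (Complex.ofReal_eq_zero.1 h3)) hμν
  · exact h3

/-- A finite-dimensional subspace which is invariant under a symmetric operator is spanned by
eigenvectors. The operator is given by its graph `G`, and only on the subspace is it needed as a
map. -/
theorem le_iSup_eigenspaces (hV : ∀ μ u, u ∈ V μ ↔ (u, (μ : ℂ) • u) ∈ G)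
    (hsymm : ∀ p ∈ G, ∀ q ∈ G, inner ℂ p.2 q.1 = inner ℂ p.1 q.2)
    (L : Submodule ℂ H) [FiniteDimensional ℂ L] (hL : ∀ v ∈ L, ∃ v' ∈ L, (v, v') ∈ G) :
    L ≤ ⨆ μ, V μ := by
  let b := Module.finBasis ℂ L
  choose g hgL hgG using fun i => hL (b i) (b i).2
  -- A linear choice of images is made on a basis; it stays in `G` because `G` is linear.
  let T : L →ₗ[ℂ] L := b.constr ℂ fun i => ⟨g i, hgL i⟩
  have hT : ∀ v : L, ((v : H), (T v : H)) ∈ G := by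
    let Φ : L →ₗ[ℂ] H × H := L.subtype.prod (L.subtype ∘ₗ T)
    have : (⊤ : Submodule ℂ L) ≤ G.comap Φ := by
      rw [← b.span_eq, Submodule.span_le]
      rintro _ ⟨i, rfl⟩
      simp only [SetLike.mem_coe, Submodule.mem_comap]
      have : Φ (b i) = ((b i : H), g i) := by
        simp [Φ, T]
      rw [this]
      exact hgG i
    exact fun v => this (Submodule.mem_top (x := v))
  have hTs : T.IsSymmetric := fun u v => hsymm _ (hT u) _ (hT v)
  intro v hv
  let e := hTs.eigenvectorBasis rfl
  have h1 := e.sum_repr (⟨v, hv⟩ : L)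
  have h2 : v = ∑ i, e.repr ⟨v, hv⟩ i • (e i : H) := by
    conv_lhs => rw [show v = ((⟨v, hv⟩ : L) : H) from rfl, ← h1]
    simp
  rw [h2]
  refine Submodule.sum_mem _ fun i _ => Submodule.smul_mem _ _ ?_
  refine Submodule.mem_iSup_of_mem (hTs.eigenvalues rfl i) ((hV _ _).2 ?_)
  have h3 := hT (e i)
  rw [hTs.apply_eigenvectorBasis] at h3
  exact h3

/-- For a nonnegative symmetric operator with a total family of eigenspaces, every `u` in its
domain is in the domain of its square root, and `‖T^{1/2} u‖² = ⟪u, T u⟫`. -/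
theorem summable_and_norm_sq_tsum_sqrt_smul [CompleteSpace H] [∀ μ, CompleteSpace (V μ)]
    (hV : ∀ μ u, u ∈ V μ ↔ (u, (μ : ℂ) • u) ∈ G)
    (hsymm : ∀ p ∈ G, ∀ q ∈ G, inner ℂ p.2 q.1 = inner ℂ p.1 q.2)
    (hnonneg : ∀ p ∈ G, 0 ≤ (inner ℂ p.2 p.1).re)
    (htot : ⊤ ≤ (⨆ μ, V μ).topologicalClosure) {u u' : H} (hu : (u, u') ∈ G) :
    (Summable fun μ : ℝ => (√μ : ℂ) • (V μ).starProjection u) ∧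
      ‖∑' μ : ℝ, (√μ : ℂ) • (V μ).starProjection u‖ ^ 2 = (inner ℂ u u').re := by
  have hO := orthogonalFamily_eigenspaces hV hsymm
  have hmem : ∀ μ, (V μ).starProjection u ∈ V μ := fun μ =>
    Submodule.starProjection_apply_mem _ _
  have hself : ∀ μ, inner ℂ ((V μ).starProjection u) u = (‖(V μ).starProjection u‖ ^ 2 : ℝ) := by
    intro μ
    have h := Submodule.starProjection_inner_eq_zero (K := V μ) u _ (hmem μ)
    rw [inner_sub_left, sub_eq_zero] at h
    rw [← inner_conj_symm, h, inner_self_eq_norm_sq_to_K]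
    simp
  have h1 : ∀ μ, inner ℂ ((V μ).starProjection u) u'
      = (μ * ‖(V μ).starProjection u‖ ^ 2 : ℝ) := by
    intro μ
    have h := hsymm _ ((hV μ _).1 (hmem μ)) _ hu
    simp only at h
    rw [← h, inner_smul_left, hself]
    simp
  have h2 : HasSum (fun μ => μ * ‖(V μ).starProjection u‖ ^ 2) (inner ℂ u u').re := by
    have h := (hasSum_starProjection hO htot u).mapL (innerSL ℂ u')
    have h' := Complex.hasSum_re h
    have e : ∀ v : H, (innerSL ℂ u' v).re = (inner ℂ v u').re := by
      intro v
      rw [innerSL_apply_apply, ← inner_conj_symm, Complex.conj_re]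
    simp only [e, h1, Complex.ofReal_re] at h'
    exact h'
  have h3 : ∀ μ, ‖(√μ : ℂ) • (V μ).starProjection u‖ ^ 2 = μ * ‖(V μ).starProjection u‖ ^ 2 := by
    intro μ
    rw [norm_smul, mul_pow, Complex.norm_real, Real.norm_eq_abs, sq_abs]
    rcases le_or_gt 0 μ with hμ | hμ
    · rw [Real.sq_sqrt hμ]
    · -- Here `√μ` is the junk value `0`, but there are no negative eigenvalues.
      have h := hnonneg _ ((hV μ _).1 (hmem μ))
      simp only [inner_smul_left, inner_self_eq_norm_sq_to_K, Complex.conj_ofReal] at h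
      have h5 : 0 ≤ μ * ‖(V μ).starProjection u‖ ^ 2 := by
        have : ((μ : ℂ) * ((‖(V μ).starProjection u‖ : ℝ) : ℂ) ^ 2).re
            = μ * ‖(V μ).starProjection u‖ ^ 2 := by
          rw [← Complex.ofReal_pow, ← Complex.ofReal_mul, Complex.ofReal_re]
        rw [← this]
        exact h
      have h6 : ‖(V μ).starProjection u‖ ^ 2 = 0 := by
        nlinarith [sq_nonneg ‖(V μ).starProjection u‖]
      rw [h6]; ring
  let w : ∀ μ, V μ := fun μ => ⟨(√μ : ℂ) • (V μ).starProjection u,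
    (V μ).smul_mem _ (hmem μ)⟩
  have hw : ∀ μ, ‖w μ‖ ^ 2 = μ * ‖(V μ).starProjection u‖ ^ 2 := h3
  have hsum : Summable fun μ => (V μ).subtypeₗᵢ (w μ) := by
    rw [hO.summable_iff_norm_sq_summable]
    simp only [hw]
    exact h2.summable
  refine ⟨hsum, ?_⟩
  have t1 : Tendsto (fun s : Finset ℝ => ‖∑ μ ∈ s, (V μ).subtypeₗᵢ (w μ)‖ ^ 2) atTop
      (𝓝 (‖∑' μ, (V μ).subtypeₗᵢ (w μ)‖ ^ 2)) := (hsum.hasSum.norm).pow 2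
  simp only [hO.norm_sum, hw] at t1
  exact tendsto_nhds_unique t1 h2

end AbstractSpectral

/-! ### Density of the spherical harmonics -/

section SphericalHarmonics

open Filter Topology

variable {n : ℕ}

local notation "𝔼" => EuclideanSpace ℝ (Fin n)

/-- The space of affine functions on `ℝⁿ`, with complex coefficients. Its `k`-th power, in the
algebra of functions, is the space of polynomial functions of degree at most `k`. -/
def affineFns (n : ℕ) : Submodule ℂ (EuclideanSpace ℝ (Fin n) → ℂ) :=
  Submodule.span ℂ (insert 1 (range fun (i : Fin n) (x : EuclideanSpace ℝ (Fin n)) => (x i : ℂ)))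

theorem one_le_affineFns : 1 ≤ affineFns n :=
  Submodule.one_le.2 (Submodule.subset_span (mem_insert _ _))

theorem coord_mem_affineFns (i : Fin n) : (fun x : 𝔼 => (x i : ℂ)) ∈ affineFns n :=
  Submodule.subset_span (mem_insert_of_mem _ ⟨i, rfl⟩)

theorem affineFns_fg : (affineFns n).FG :=
  Submodule.fg_span ((finite_range _).insert _)

theorem linDeriv_coord (A : 𝔼 →L[ℝ] 𝔼) (i : Fin n) :
    linDeriv A (fun x : 𝔼 => (x i : ℂ)) = fun x => ((A x) i : ℂ) := by
  funext x
  have : (fun x : 𝔼 => (x i : ℂ)) = (Complex.ofRealCLM.comp (EuclideanSpace.proj (𝕜 := ℝ) i) :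
      𝔼 →L[ℝ] ℂ) := by
    ext; simp
  rw [linDeriv, this, ContinuousLinearMap.fderiv]
  simp

theorem linDeriv_coord_mem (A : 𝔼 →L[ℝ] 𝔼) (i : Fin n) :
    (fun x : 𝔼 => ((A x) i : ℂ)) ∈ affineFns n := by
  have : (fun x : 𝔼 => ((A x) i : ℂ))
      = ∑ j, ((A (EuclideanSpace.single j 1)) i : ℂ) • fun x : 𝔼 => (x j : ℂ) := by
    funext x
    conv_lhs => rw [← euclidean_sum_single x]
    simp [mul_comm]
  rw [this]
  exact Submodule.sum_mem _ fun j _ => Submodule.smul_mem _ _ (coord_mem_affineFns j)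

theorem linDeriv_add_fun (A : 𝔼 →L[ℝ] 𝔼) {f g : 𝔼 → ℂ} (hf : ContDiff ℝ ∞ f)
    (hg : ContDiff ℝ ∞ g) : linDeriv A (f + g) = linDeriv A f + linDeriv A g := by
  funext x
  simp [linDeriv, fderiv_add (hf.differentiable (by simp) x) (hg.differentiable (by simp) x)]

/-- Polynomial functions are smooth, and those of degree at most `k` are invariant under complex
conjugation and under derivatives along linear vector fields. -/
theorem affineFns_pow_invariant (k : ℕ) {f : 𝔼 → ℂ} (hf : f ∈ affineFns n ^ k) :
    ContDiff ℝ ∞ f ∧ star f ∈ affineFns n ^ k ∧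
      ∀ A : 𝔼 →L[ℝ] 𝔼, linDeriv A f ∈ affineFns n ^ k := by
  have hconst : ∀ (c : ℂ) (A : 𝔼 →L[ℝ] 𝔼), linDeriv A (fun _ : 𝔼 => c) = 0 := by
    intro c A
    funext x
    simp [linDeriv]
  have hadd : ∀ {L : Submodule ℂ (𝔼 → ℂ)} {f g : 𝔼 → ℂ},
      (ContDiff ℝ ∞ f ∧ star f ∈ L ∧ ∀ A : 𝔼 →L[ℝ] 𝔼, linDeriv A f ∈ L) →
      (ContDiff ℝ ∞ g ∧ star g ∈ L ∧ ∀ A : 𝔼 →L[ℝ] 𝔼, linDeriv A g ∈ L) →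
      (ContDiff ℝ ∞ (f + g) ∧ star (f + g) ∈ L ∧ ∀ A : 𝔼 →L[ℝ] 𝔼, linDeriv A (f + g) ∈ L) := by
    intro L f g hf hg
    refine ⟨hf.1.add hg.1, ?_, fun A => ?_⟩
    · rw [star_add]
      exact L.add_mem hf.2.1 hg.2.1
    · rw [linDeriv_add_fun A hf.1 hg.1]
      exact L.add_mem (hf.2.2 A) (hg.2.2 A)
  have h1 : ∀ {f : 𝔼 → ℂ}, f ∈ affineFns n → ContDiff ℝ ∞ f ∧ star f ∈ affineFns n ∧
      ∀ A : 𝔼 →L[ℝ] 𝔼, linDeriv A f ∈ affineFns n := by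
    intro f hf
    induction hf using Submodule.span_induction with
    | mem f h =>
      rcases h with rfl | ⟨i, rfl⟩
      · refine ⟨contDiff_const, ?_, fun A => ?_⟩
        · rw [star_one]
          exact Submodule.subset_span (mem_insert _ _)
        · rw [show (1 : 𝔼 → ℂ) = fun _ => 1 from rfl, hconst]
          exact Submodule.zero_mem _
      · refine ⟨Complex.ofRealCLM.contDiff.comp
          (EuclideanSpace.proj (𝕜 := ℝ) i : 𝔼 →L[ℝ] ℝ).contDiff, ?_, fun A => ?_⟩
        · have : star (fun x : 𝔼 => (x i : ℂ)) = fun x : 𝔼 => (x i : ℂ) := by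
            funext x
            simp
          rw [this]
          exact coord_mem_affineFns i
        · rw [linDeriv_coord]
          exact linDeriv_coord_mem A i
    | zero =>
      refine ⟨contDiff_const, by simp, fun A => ?_⟩
      rw [show (0 : 𝔼 → ℂ) = fun _ => 0 from rfl, hconst]
      exact Submodule.zero_mem _
    | add f g _ _ hf hg => exact hadd hf hg
    | smul c f _ hf =>
      refine ⟨contDiff_const.smul hf.1, ?_, fun A => ?_⟩
      · rw [star_smul]
        exact Submodule.smul_mem _ _ hf.2.1
      · have : linDeriv A (c • f) = c • linDeriv A f := by
          funext x
          simp [linDeriv, fderiv_const_smul (hf.1.differentiable (by simp) x)]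
        rw [this]
        exact Submodule.smul_mem _ _ (hf.2.2 A)
  induction k generalizing f with
  | zero =>
    rw [pow_zero, Submodule.mem_one] at hf
    obtain ⟨c, rfl⟩ := hf
    refine ⟨contDiff_const, ?_, fun A => ?_⟩
    · rw [pow_zero, Submodule.mem_one]
      exact ⟨star c, by ext; simp [Algebra.algebraMap_eq_smul_one]⟩
    · change linDeriv A (fun _ => c) ∈ _
      rw [hconst]
      exact Submodule.zero_mem _
  | succ k ih =>
    rw [pow_succ] at hf ⊢
    induction hf using Submodule.mul_induction_on' with
    | mem_mul_mem f hf g hg =>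
      obtain ⟨hf1, hf2, hf3⟩ := ih hf
      obtain ⟨hg1, hg2, hg3⟩ := h1 hg
      refine ⟨hf1.mul hg1, ?_, fun A => ?_⟩
      · rw [star_mul']
        exact Submodule.mul_mem_mul hf2 hg2
      · have : linDeriv A (f * g) = linDeriv A f * g + f * linDeriv A g := by
          funext x
          simp only [linDeriv, Pi.add_apply, Pi.mul_apply]
          rw [fderiv_mul (hf1.differentiable (by simp) x) (hg1.differentiable (by simp) x)]
          simp only [_root_.add_apply, _root_.smul_apply, smul_eq_mul]
          ring
        rw [this]
        exact Submodule.add_mem _ (Submodule.mul_mem_mul (hf3 A) hg)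
          (Submodule.mul_mem_mul hf (hg3 A))
    | add f _ g _ hf hg => exact hadd hf hg

theorem angLaplacian_mem_affineFns_pow {k : ℕ} {f : 𝔼 → ℂ} (hf : f ∈ affineFns n ^ k) :
    angLaplacian f ∈ affineFns n ^ k := by
  have : angLaplacian f = ((1 / 2 : ℝ) : ℂ) •
      ∑ i, ∑ j, linDeriv (rotGen i j) (linDeriv (rotGen i j) f) := by
    funext x
    simp [angLaplacian, Finset.sum_apply]
  rw [this]
  exact Submodule.smul_mem _ _ (Submodule.sum_mem _ fun i _ => Submodule.sum_mem _ fun j _ =>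
    (affineFns_pow_invariant k ((affineFns_pow_invariant k hf).2.2 _)).2.2 _)

/-- The restriction to the sphere of the polynomial functions of degree at most `k`. -/
def restrictPoly (n k : ℕ) : ↥(affineFns n ^ k) →ₗ[ℂ] C(USphere n, ℂ) where
  toFun f := ⟨fun θ => (f : EuclideanSpace ℝ (Fin n) → ℂ) θ,
    (affineFns_pow_invariant k f.2).1.continuous.comp continuous_subtype_val⟩
  map_add' _ _ := rfl
  map_smul' _ _ := rfl

/-- The polynomial functions on the sphere. -/
def spherePoly (n : ℕ) : StarSubalgebra ℂ C(USphere n, ℂ) where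
  carrier := {g | ∃ k, ∃ f : ↥(affineFns n ^ k), restrictPoly n k f = g}
  mul_mem' := by
    rintro _ _ ⟨k, f, rfl⟩ ⟨l, g, rfl⟩
    refine ⟨k + l, ⟨f * g, ?_⟩, rfl⟩
    rw [pow_add]
    exact Submodule.mul_mem_mul f.2 g.2
  add_mem' := by
    rintro _ _ ⟨k, f, rfl⟩ ⟨l, g, rfl⟩
    refine ⟨max k l, ⟨f + g, Submodule.add_mem _ ?_ ?_⟩, rfl⟩
    · exact pow_le_pow_right₀ one_le_affineFns (le_max_left k l) f.2
    · exact pow_le_pow_right₀ one_le_affineFns (le_max_right k l) g.2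
  algebraMap_mem' c := ⟨0, ⟨algebraMap ℂ _ c, by
    rw [pow_zero]
    exact Submodule.algebraMap_mem c⟩, rfl⟩
  star_mem' := by
    rintro _ ⟨k, f, rfl⟩
    exact ⟨k, ⟨star f, (affineFns_pow_invariant k f.2).2.1⟩, rfl⟩

theorem spherePoly_separatesPoints : (spherePoly n).SeparatesPoints := by
  intro θ φ h
  have : ∃ i, (θ : 𝔼) i ≠ (φ : 𝔼) i := by
    by_contra! h'
    exact h (Subtype.ext (by ext i; exact h' i))
  obtain ⟨i, hi⟩ := this
  refine ⟨_, ⟨_, ⟨1, ⟨fun x => (x i : ℂ), by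
    rw [pow_one]
    exact coord_mem_affineFns i⟩, rfl⟩, rfl⟩, ?_⟩
  simpa [restrictPoly] using hi

theorem toLp_restrictPoly_mem_iSup (hn : 0 < n) (k : ℕ) (f : ↥(affineFns n ^ k)) :
    ContinuousMap.toLp 2 (sphereMeasure n) ℂ (restrictPoly n k f)
      ∈ ⨆ μ, sphereEigenspace n μ := by
  set Φ : ↥(affineFns n ^ k) →ₗ[ℂ] SphereL2 n :=
    (ContinuousMap.toLp 2 (sphereMeasure n) ℂ).toLinearMap ∘ₗ restrictPoly n k with hΦ
  have : Module.Finite ℂ ↥(affineFns n ^ k) :=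
    Module.Finite.iff_fg.2 (affineFns_fg.pow k)
  refine le_iSup_eigenspaces (G := negLaplacianGraph n) (fun μ u => mem_sphereEigenspace)
    (fun p hp q hq => inner_graph_symm hn hp hq) (LinearMap.range Φ) ?_ ⟨f, rfl⟩
  rintro _ ⟨g, rfl⟩
  have hg := (affineFns_pow_invariant k g.2).1
  refine ⟨Φ (-⟨_, angLaplacian_mem_affineFns_pow g.2⟩), ⟨_, rfl⟩,
    Submodule.le_topologicalClosure _ (Submodule.subset_span ⟨polar g 1,
      sphereSmooth_polar hg.contDiffOn one_pos, ?_, ?_⟩)⟩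
  · refine (ContinuousMap.coeFn_toLp _ _).trans (.of_forall fun θ => ?_)
    simp [restrictPoly, polar]
  · refine (ContinuousMap.coeFn_toLp _ _).trans (.of_forall fun θ => ?_)
    simp [restrictPoly, sphereLaplacian_polar hg.contDiffOn one_pos]

/-- The eigenspaces of `-Δ_S` are total in `L²`. -/
theorem iSup_sphereEigenspace_dense (hn : 0 < n) :
    ⊤ ≤ (⨆ μ, sphereEigenspace n μ).topologicalClosure := by
  have h1 : Dense (spherePoly n : Set C(USphere n, ℂ)) := by
    rw [dense_iff_closure_eq, ← StarSubalgebra.topologicalClosure_coe,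
      ContinuousMap.starSubalgebra_topologicalClosure_eq_top_of_separatesPoints _
        spherePoly_separatesPoints]
    rfl
  have h2 := (ContinuousMap.toLp_denseRange (E := ℂ) (μ := sphereMeasure n) (p := 2) ℂ
    (by simp)).dense_image (ContinuousLinearMap.continuous _) h1
  intro u _
  refine closure_mono ?_ (h2 u)
  rintro _ ⟨_, ⟨k, f, rfl⟩, rfl⟩
  exact toLp_restrictPoly_mem_iSup hn k f

/-- Smooth functions on the sphere are in the domain of `(-Δ_S)^{1/2}`, and
`‖(-Δ_S)^{1/2} u‖² = ⟪u, -Δ_S u⟫`. -/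
theorem mem_sphereSqrtDomain_and_norm_sq (hn : 0 < n) {u : USphere n → ℂ} (hu : SphereSmooth u) :
    toSphereL2 u ∈ sphereSqrtDomain n ∧ ‖sphereSqrt n (toSphereL2 u)‖ ^ 2
      = -∫ θ, inner ℝ (u θ) (sphereLaplacian u θ) ∂sphereMeasure n := by
  have h := summable_and_norm_sq_tsum_sqrt_smul (V := sphereEigenspace n)
    (fun μ u => mem_sphereEigenspace)
    (fun p hp q hq => inner_graph_symm hn hp hq) (fun p hp => re_inner_graph_nonneg hn hp)
    (iSup_sphereEigenspace_dense hn) (mem_negLaplacianGraph hu)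
  refine ⟨h.1, h.2.trans ?_⟩
  have h2 : toSphereL2 (fun θ => -sphereLaplacian u θ) =ᵐ[sphereMeasure n]
      fun θ => -sphereLaplacian u θ := coeFn_toSphereL2 hu.continuous_sphereLaplacian.neg
  rw [re_inner_sphereL2 (coeFn_toSphereL2 hu.continuous) h2, ← integral_neg]
  simp

end SphericalHarmonics

/-! ### The angular integrals as weighted pairings -/

section AngularIntegrals

open Filter Topology

variable {n : ℕ}

local notation "𝔼" => EuclideanSpace ℝ (Fin n)

theorem integral_mul_norm_sq_sphereL2 (c : ℝ) (v : SphereL2 n) :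
    ∫ θ, c * ‖v θ‖ ^ 2 ∂sphereMeasure n = c * ‖v‖ ^ 2 := by
  have h := re_inner_sphereL2 (ae_eq_refl v) (ae_eq_refl v)
  have h2 : (inner ℂ v v).re = ‖v‖ ^ 2 := inner_self_eq_norm_sq (𝕜 := ℂ) v
  rw [integral_const_mul, ← h2, h]
  simp only [real_inner_self_eq_norm_sq]

theorem sqrtTerm_eq (hn : 0 < n) {f : 𝔼 → ℂ} (hf : ContDiffOn ℝ ∞ f {0}ᶜ) (p : ℝ) {r : ℝ}
    (hr : 0 < r) : sqrtTerm p f r = (∫ θ : USphere n, (fun x : 𝔼 =>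
      -(‖x‖ ^ p * inner ℝ (f x) (angLaplacian f x))) (r • (θ : 𝔼)) ∂sphereMeasure n)
        * r ^ (n - 1) := by
  have hθ : ∀ θ : USphere n, ‖r • (θ : 𝔼)‖ = r := fun θ => by
    rw [norm_smul, mem_sphere_zero_iff_norm.1 θ.2, mul_one, Real.norm_of_nonneg hr.le]
  rw [sqrtTerm, integral_mul_norm_sq_sphereL2,
    (mem_sphereSqrtDomain_and_norm_sq hn (sphereSmooth_polar hf hr)).2]
  simp only [hθ, integral_neg, integral_const_mul, sphereLaplacian_polar hf hr, polar]
  ring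

theorem integrable_weighted_pairing (s : ℝ) {a b : 𝔼 → ℂ} (ha : IsTest a)
    (hb : ContDiffOn ℝ ∞ b {0}ᶜ) : Integrable fun x : 𝔼 => ‖x‖ ^ s * inner ℝ (a x) (b x) :=
  (isTest_mul_inner (contDiffOn_norm_rpow s) ha.contDiffOn hb (Or.inr ha)).integrable

theorem integrableOn_and_integral_sqrtTerm (hn : 0 < n) {f : 𝔼 → ℂ} (hf : IsTest f) (p : ℝ) :
    IntegrableOn (sqrtTerm p f) (Ioi 0) ∧
    ∫ r in Ioi (0 : ℝ), sqrtTerm p f r = -pairing (fun x => ‖x‖ ^ p) f (angLaplacian f) := by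
  have h := integrableOn_and_integral_polar hn
    (integrable_weighted_pairing p hf hf.angLaplacian.contDiffOn).neg
  have he : EqOn (sqrtTerm p f) (fun r : ℝ => (∫ θ : USphere n, (fun x : 𝔼 =>
      -(‖x‖ ^ p * inner ℝ (f x) (angLaplacian f x))) (r • (θ : 𝔼)) ∂sphereMeasure n)
        * r ^ (n - 1)) (Ioi 0) := fun r hr => sqrtTerm_eq hn hf.contDiffOn p hr
  refine ⟨h.1.congr_fun he.symm measurableSet_Ioi, ?_⟩
  rw [setIntegral_congr_fun measurableSet_Ioi he, pairing, ← integral_neg]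
  exact h.2

theorem integrableOn_and_integral_lapTerm (hn : 0 < n) {f : 𝔼 → ℂ} (hf : IsTest f) (p : ℝ) :
    IntegrableOn (lapTerm p f) (Ioi 0) ∧
    ∫ r in Ioi (0 : ℝ), lapTerm p f r
      = pairing (fun x => ‖x‖ ^ p) (angLaplacian f) (angLaplacian f) := by
  have h := integrableOn_and_integral_polar hn
    (integrable_weighted_pairing p hf.angLaplacian hf.angLaplacian.contDiffOn)
  have he : EqOn (lapTerm p f) (fun r : ℝ => (∫ θ : USphere n, (fun x : 𝔼 =>
      ‖x‖ ^ p * inner ℝ (angLaplacian f x) (angLaplacian f x)) (r • (θ : 𝔼)) ∂sphereMeasure n)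
        * r ^ (n - 1)) (Ioi 0) := by
    intro r hr
    have hθ : ∀ θ : USphere n, ‖r • (θ : 𝔼)‖ = r := fun θ => by
      rw [norm_smul, mem_sphere_zero_iff_norm.1 θ.2, mul_one, Real.norm_of_nonneg (le_of_lt hr)]
    simp only [lapTerm, sphereLaplacian_polar hf.contDiffOn hr, hθ, real_inner_self_eq_norm_sq]
  refine ⟨h.1.congr_fun he.symm measurableSet_Ioi, ?_⟩
  rw [setIntegral_congr_fun measurableSet_Ioi he]
  exact h.2

theorem polarDeriv_eq {f : 𝔼 → ℂ} (hf : Differentiable ℝ f) {r : ℝ} (hr : 0 < r) :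
    polarDeriv f r = (((r⁻¹ : ℝ) : ℂ)) • polar (linDeriv (.id ℝ 𝔼) f) r := by
  funext θ
  have h1 : HasDerivAt (fun s : ℝ => s • (θ : 𝔼)) (θ : 𝔼) r := by
    simpa using (hasDerivAt_id r).smul_const (θ : 𝔼)
  have h2 := ((hf (r • (θ : 𝔼))).hasFDerivAt.comp_hasDerivAt r h1).deriv
  change deriv (f ∘ fun s : ℝ => s • (θ : 𝔼)) r = _
  rw [h2]
  simp only [Pi.smul_apply, polar, linDeriv, ContinuousLinearMap.id_apply, map_smul]
  rw [Complex.coe_smul, smul_smul, inv_mul_cancel₀ hr.ne', one_smul]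

theorem toSphereL2_smul (c : ℂ) {u : USphere n → ℂ} (hu : Continuous u) :
    toSphereL2 (c • u) = c • toSphereL2 u := by
  refine Lp.ext ((coeFn_toSphereL2 (hu.const_smul c)).trans ?_)
  exact (((coeFn_toSphereL2 hu).const_smul c).symm).trans (Lp.coeFn_smul _ _).symm

theorem sphereSqrt_smul (c : ℂ) (u : SphereL2 n) : sphereSqrt n (c • u) = c • sphereSqrt n u := by
  simp only [sphereSqrt, map_smul]
  rw [← tsum_const_smul'']
  simp only [smul_comm c]

theorem toSphereL2_polarDeriv {f : 𝔼 → ℂ} (hf : IsTest f) {r : ℝ} (hr : 0 < r) :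
    toSphereL2 (polarDeriv f r)
      = ((r⁻¹ : ℝ) : ℂ) • toSphereL2 (polar (linDeriv (.id ℝ 𝔼) f) r) := by
  rw [polarDeriv_eq (hf.contDiff.differentiable (by simp)) hr, toSphereL2_smul]
  exact (sphereSmooth_polar (contDiffOn_linDeriv _ hf.contDiffOn) hr).continuous

/-- As `∂_r f = r⁻¹ (r ∂_r f)`, the radial integrand built on `∂_r f` and `r^{γ-2}` is
the one built on `r ∂_r f` and `r^{γ-4}`. -/
theorem sqrtDerivTerm_eq {f : 𝔼 → ℂ} (hf : IsTest f) (γ : ℝ) {r : ℝ} (hr : 0 < r) :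
    sqrtDerivTerm (γ - 2) f r = sqrtTerm (γ - 4) (linDeriv (.id ℝ 𝔼) f) r := by
  rw [sqrtDerivTerm, sqrtTerm, integral_mul_norm_sq_sphereL2, integral_mul_norm_sq_sphereL2,
    toSphereL2_polarDeriv hf hr, sphereSqrt_smul, norm_smul, mul_pow, Complex.norm_real,
    Real.norm_eq_abs, sq_abs, ← mul_assoc]
  have : r ^ (γ - 2) * r⁻¹ ^ 2 = r ^ (γ - 4) := by
    rw [inv_pow, ← Real.rpow_natCast, ← Real.rpow_neg hr.le, ← Real.rpow_add hr]
    congr 1; push_cast; ring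
  rw [this]

theorem integrableOn_and_integral_sqrtDerivTerm (hn : 0 < n) {f : 𝔼 → ℂ} (hf : IsTest f)
    (γ : ℝ) :
    IntegrableOn (sqrtDerivTerm (γ - 2) f) (Ioi 0) ∧
    ∫ r in Ioi (0 : ℝ), sqrtDerivTerm (γ - 2) f r
      = -pairing (fun x => ‖x‖ ^ (γ - 4)) (linDeriv (.id ℝ 𝔼) f)
        (angLaplacian (linDeriv (.id ℝ 𝔼) f)) := by
  have h := integrableOn_and_integral_sqrtTerm hn (hf.linDeriv (.id ℝ 𝔼)) (γ - 4)
  have he : EqOn (sqrtDerivTerm (γ - 2) f) (sqrtTerm (γ - 4) (linDeriv (.id ℝ 𝔼) f)) (Ioi 0) :=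
    fun r hr => sqrtDerivTerm_eq hf γ hr
  refine ⟨h.1.congr_fun he.symm measurableSet_Ioi, ?_⟩
  rw [setIntegral_congr_fun measurableSet_Ioi he]
  exact h.2

end AngularIntegrals

/-! ### The weighted integral identities -/

section WeightedIdentities

open Filter Topology

variable {n : ℕ}

local notation "𝔼" => EuclideanSpace ℝ (Fin n)

theorem ae_ne_zero (hn : 0 < n) : ∀ᵐ x : 𝔼, x ≠ 0 := by
  have : Nonempty (Fin n) := ⟨⟨0, hn⟩⟩
  exact compl_mem_ae_iff.2 (measure_singleton (0 : 𝔼))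

theorem linDeriv_rotGen_norm_rpow (s : ℝ) (i j : Fin n) (x : 𝔼) (hx : x ≠ 0) :
    linDeriv (rotGen i j) (fun y : 𝔼 => ‖y‖ ^ s) x = 0 := by
  rw [linDeriv_norm_rpow _ _ hx, inner_rotGen, mul_zero]

/-- The adjoint of the Euler operator with respect to the weight `|x|^s`. -/
theorem pairing_euler (s : ℝ) {a b : 𝔼 → ℂ} (ha : IsTest a) (hb : IsTest b) :
    pairing (fun x => ‖x‖ ^ s) (linDeriv (.id ℝ 𝔼) a) b
      = -pairing (fun x => ‖x‖ ^ s) a (linDeriv (.id ℝ 𝔼) b)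
        - (s + n) * pairing (fun x => ‖x‖ ^ s) a b := by
  rw [pairing_linDeriv (c := s) _ (contDiffOn_norm_rpow s) ha.contDiffOn hb.contDiffOn
    (Or.inr ha) fun x hx => ?_, linTrace_id]
  rw [linDeriv_norm_rpow _ _ hx, ContinuousLinearMap.id_apply, real_inner_self_eq_norm_sq,
    mul_assoc, ← Real.rpow_natCast, ← Real.rpow_add (norm_pos_iff.2 hx)]
  congr 2; push_cast; ring

theorem pairing_angLaplacian_symm_rpow (s : ℝ) {a b : 𝔼 → ℂ} (ha : IsTest a) (hb : IsTest b) :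
    pairing (fun x => ‖x‖ ^ s) (angLaplacian a) b
      = pairing (fun x => ‖x‖ ^ s) a (angLaplacian b) :=
  pairing_angLaplacian_symm (contDiffOn_norm_rpow s) ha.contDiffOn hb.contDiffOn
    (Or.inr ⟨ha, hb⟩) (linDeriv_rotGen_norm_rpow s)

theorem pairing_euler_angLaplacian (hn : 0 < n) (s : ℝ) {f a : 𝔼 → ℂ} (hf : IsTest f) :
    pairing (fun x => ‖x‖ ^ s) a (linDeriv (.id ℝ 𝔼) (angLaplacian f))
      = pairing (fun x => ‖x‖ ^ s) a (angLaplacian (linDeriv (.id ℝ 𝔼) f)) := by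
  refine integral_congr_ae ?_
  filter_upwards [ae_ne_zero hn] with x hx
  rw [angLaplacian_euler hf.contDiffOn hx]

theorem pairing_linearCombination (s : ℝ) {a₁ a₂ a₃ a₄ b : 𝔼 → ℂ} (h₁ : IsTest a₁)
    (h₂ : IsTest a₂) (h₃ : IsTest a₃) (h₄ : IsTest a₄) (hb : ContDiffOn ℝ ∞ b {0}ᶜ)
    (c₁ c₂ c₃ c₄ : ℝ) :
    pairing (fun x => ‖x‖ ^ s) (fun x => c₁ • a₁ x + c₂ • a₂ x + c₃ • a₃ x + c₄ • a₄ x) b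
      = c₁ * pairing (fun x => ‖x‖ ^ s) a₁ b + c₂ * pairing (fun x => ‖x‖ ^ s) a₂ b
        + c₃ * pairing (fun x => ‖x‖ ^ s) a₃ b + c₄ * pairing (fun x => ‖x‖ ^ s) a₄ b := by
  have i₁ := (integrable_weighted_pairing s h₁ hb).const_mul c₁
  have i₂ := (integrable_weighted_pairing s h₂ hb).const_mul c₂
  have i₃ := (integrable_weighted_pairing s h₃ hb).const_mul c₃
  have i₄ := (integrable_weighted_pairing s h₄ hb).const_mul c₄
  simp only [pairing, ← integral_const_mul]
  rw [← integral_add i₁ i₂, ← integral_add (by exact i₁.add i₂) i₃,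
    ← integral_add (by exact (i₁.add i₂).add i₃) i₄]
  refine integral_congr_ae (.of_forall fun x => ?_)
  simp only [inner_add_left, real_inner_smul_left]
  ring

/-- The square of the weighted norm of a linear combination of `(r ∂_r)² f`, `r ∂_r f`, `Δ_S f` and
`f`, in terms of `|r ∂_r f|²`, `|f|²` and the angular integrals. -/
theorem pairing_self_combination (hn : 0 < n) (s : ℝ) {f : 𝔼 → ℂ} (hf : IsTest f)
    (c₁ c₂ c₃ c₄ : ℝ) {T : 𝔼 → ℂ}
    (hT : T = fun x => c₁ • linDeriv (.id ℝ 𝔼) (linDeriv (.id ℝ 𝔼) f) x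
      + c₂ • linDeriv (.id ℝ 𝔼) f x + c₃ • angLaplacian f x + c₄ • f x) {A B C e p : ℝ}
    (hA : A = -pairing (fun x => ‖x‖ ^ s) f (angLaplacian f))
    (hB : B = -pairing (fun x => ‖x‖ ^ s) (linDeriv (.id ℝ 𝔼) f)
      (angLaplacian (linDeriv (.id ℝ 𝔼) f)))
    (hC : C = pairing (fun x => ‖x‖ ^ s) (angLaplacian f) (angLaplacian f))
    (he : e = pairing (fun x => ‖x‖ ^ s) (linDeriv (.id ℝ 𝔼) f) (linDeriv (.id ℝ 𝔼) f))
    (hp : p = pairing (fun x => ‖x‖ ^ s) f f) :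
    pairing (fun x => ‖x‖ ^ s) T T
      = c₁ ^ 2 * pairing (fun x => ‖x‖ ^ s) (linDeriv (.id ℝ 𝔼) (linDeriv (.id ℝ 𝔼) f))
          (linDeriv (.id ℝ 𝔼) (linDeriv (.id ℝ 𝔼) f))
        + c₂ ^ 2 * e + c₃ ^ 2 * C + c₄ ^ 2 * p
        - c₁ * c₂ * (s + n) * e + 2 * c₁ * c₃ * (B - (s + n) ^ 2 / 2 * A)
        + 2 * c₁ * c₄ * ((s + n) ^ 2 / 2 * p - e) + c₂ * c₃ * (s + n) * A
        - c₂ * c₄ * (s + n) * p - 2 * c₃ * c₄ * A := by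
  have h1 := hf.linDeriv (.id ℝ 𝔼)
  have h2 := h1.linDeriv (.id ℝ 𝔼)
  have h3 := hf.angLaplacian
  have hTs : ContDiffOn ℝ ∞ T {0}ᶜ := by
    rw [hT]
    exact (((h2.contDiffOn.const_smul c₁).add (h1.contDiffOn.const_smul c₂)).add
      (h3.contDiffOn.const_smul c₃)).add (hf.contDiffOn.const_smul c₄)
  have hL : ∀ {b : 𝔼 → ℂ}, ContDiffOn ℝ ∞ b {0}ᶜ → _ := fun {b} hb =>
    pairing_linearCombination s h2 h1 h3 hf hb c₁ c₂ c₃ c₄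
  simp only [← hT] at hL
  rw [hL hTs, pairing_comm _ _ T, pairing_comm _ _ T, pairing_comm _ _ T, pairing_comm _ _ T,
    hL h2.contDiffOn, hL h1.contDiffOn, hL h3.contDiffOn, hL hf.contDiffOn]
  have k1 := pairing_euler s hf hf
  have k2 := pairing_euler s h1 h1
  have k3 := pairing_euler s h1 hf
  have k4 := pairing_euler s hf h3
  have k5 := pairing_euler s h1 h3
  rw [pairing_euler_angLaplacian hn s hf] at k4 k5
  rw [← pairing_angLaplacian_symm_rpow s hf h1] at k4
  generalize linDeriv (.id ℝ 𝔼) (linDeriv (.id ℝ 𝔼) f) = e₂ at *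
  generalize angLaplacian (linDeriv (.id ℝ 𝔼) f) = σ₁ at *
  generalize linDeriv (.id ℝ 𝔼) f = e₁ at *
  generalize angLaplacian f = σ at *
  rw [pairing_comm _ f e₁] at k1
  rw [pairing_comm _ e₁ e₂] at k2
  rw [pairing_comm _ σ e₁] at k4
  have g1 : pairing (fun x => ‖x‖ ^ s) e₁ f = -((s + n) / 2) * p := by
    rw [hp]; linarith
  have g2 : pairing (fun x => ‖x‖ ^ s) e₂ e₁ = -((s + n) / 2) * e := by
    rw [he]; linarith
  have g3 : pairing (fun x => ‖x‖ ^ s) e₂ f = (s + n) ^ 2 / 2 * p - e := by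
    rw [k3, g1, ← he]; ring
  have g4 : pairing (fun x => ‖x‖ ^ s) e₁ σ = (s + n) / 2 * A := by
    rw [hA]; linarith
  have g5 : pairing (fun x => ‖x‖ ^ s) e₂ σ = B - (s + n) ^ 2 / 2 * A := by
    rw [k5, g4, hB]; ring
  have g6 : pairing (fun x => ‖x‖ ^ s) f σ = -A := by rw [hA]; ring
  rw [pairing_comm _ e₁ e₂, pairing_comm _ σ e₂, pairing_comm _ f e₂, pairing_comm _ f e₁,
    pairing_comm _ σ e₁, pairing_comm _ σ f, g1, g2, g3, g4, g5, g6, ← he, ← hp, ← hC]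
  ring

/-- The splitting of the weighted integral of `|∇f|²` into its radial and its angular part; Green's
formula turns the latter into the pairing of `f` with `-Δ_S f`. -/
theorem integral_gradSq (hn : 0 < n) (γ : ℝ) {f : 𝔼 → ℂ} (hf : IsTest f) :
    ∫ x : 𝔼, ‖x‖ ^ (γ - 2) * gradSq f x
      = pairing (fun x => ‖x‖ ^ (γ - 4)) (linDeriv (.id ℝ 𝔼) f) (linDeriv (.id ℝ 𝔼) f)
        - pairing (fun x => ‖x‖ ^ (γ - 4)) f (angLaplacian f) := by
  have hi : ∀ A : 𝔼 →L[ℝ] 𝔼, Integrable fun x : 𝔼 =>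
      ‖x‖ ^ (γ - 4) * inner ℝ (linDeriv A f x) (linDeriv A f x) := fun A =>
    integrable_weighted_pairing _ (hf.linDeriv A) (hf.linDeriv A).contDiffOn
  rw [← pairing_angLaplacian_symm_rpow _ hf hf, pairing_angLaplacian (contDiffOn_norm_rpow _)
    hf.contDiffOn hf.contDiffOn (Or.inr hf) (linDeriv_rotGen_norm_rpow _), sub_neg_eq_add]
  simp only [pairing]
  simp_rw [← integral_finsetSum Finset.univ fun j _ => hi (rotGen _ j)]
  rw [← integral_finsetSum Finset.univ fun i _ =>
    integrable_finsetSum Finset.univ fun j _ => hi (rotGen i j), ← integral_const_mul,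
    ← integral_add (hi _) ((integrable_finsetSum Finset.univ fun i _ =>
      integrable_finsetSum Finset.univ fun j _ => hi (rotGen i j)).const_mul _)]
  refine integral_congr_ae ?_
  filter_upwards [ae_ne_zero hn] with x hx
  have h1 : ‖x‖ ^ (γ - 2) = ‖x‖ ^ (γ - 4) * ‖x‖ ^ 2 := by
    rw [← Real.rpow_natCast, ← Real.rpow_add (norm_pos_iff.2 hx)]
    congr 1; push_cast; ring
  rw [h1, mul_assoc, norm_sq_mul_gradSq]
  simp only [real_inner_self_eq_norm_sq, ← Finset.mul_sum]
  ring

theorem pairing_angLaplacian_self_nonpos (s : ℝ) {f : 𝔼 → ℂ} (hf : IsTest f) :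
    pairing (fun x => ‖x‖ ^ s) f (angLaplacian f) ≤ 0 := by
  rw [← pairing_angLaplacian_symm_rpow _ hf hf, pairing_angLaplacian (contDiffOn_norm_rpow _)
    hf.contDiffOn hf.contDiffOn (Or.inr hf) (linDeriv_rotGen_norm_rpow _)]
  have : 0 ≤ ∑ i : Fin n, ∑ j, pairing (fun x => ‖x‖ ^ s) (linDeriv (rotGen i j) f)
      (linDeriv (rotGen i j) f) :=
    Finset.sum_nonneg fun i _ => Finset.sum_nonneg fun j _ =>
      integral_nonneg fun x => mul_nonneg (by positivity) real_inner_self_nonneg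
  linarith

/-- The function `R` is `r² Δ f`, written as a combination of the kind that
`pairing_self_combination` applies to. -/
theorem integral_laplacian_sq (hn : 0 < n) (γ : ℝ) {f : 𝔼 → ℂ} (hf : IsTest f) {R : 𝔼 → ℂ}
    (hR : R = fun x => (1 : ℝ) • linDeriv (.id ℝ 𝔼) (linDeriv (.id ℝ 𝔼) f) x
      + ((n : ℝ) - 2) • linDeriv (.id ℝ 𝔼) f x + (1 : ℝ) • angLaplacian f x + (0 : ℝ) • f x) :
    ∫ x : 𝔼, ‖x‖ ^ γ * ‖Laplacian.laplacian f x‖ ^ 2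
      = pairing (fun x => ‖x‖ ^ (γ - 4)) R R := by
  refine integral_congr_ae ?_
  filter_upwards [ae_ne_zero hn] with x hx
  have h0 : R x = ‖x‖ ^ 2 • Laplacian.laplacian f x := by
    rw [norm_sq_smul_laplacian (hf.contDiff.contDiffAt.of_le (by norm_cast)), hR]
    simp
  have h1 : ‖x‖ ^ γ = ‖x‖ ^ (γ - 4) * ‖x‖ ^ 4 := by
    rw [← Real.rpow_natCast, ← Real.rpow_add (norm_pos_iff.2 hx)]
    congr 1; push_cast; ring
  rw [h0, real_inner_self_eq_norm_sq, norm_smul, norm_pow, norm_norm, h1]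
  ring

end WeightedIdentities

theorem theoremt3p1 (n : ℕ) (hn : 2 ≤ n) (α β γ τ : ℝ)
    (f : EuclideanSpace ℝ (Fin n) → ℂ) (hf : ContDiff ℝ ∞ f)
    (hfc : HasCompactSupport f) (hf0 : (0 : EuclideanSpace ℝ (Fin n)) ∉ tsupport f) :
    ((∀ r : ℝ, 0 < r → toSphereL2 (polar f r) ∈ sphereSqrtDomain n ∧
        toSphereL2 (polarDeriv f r) ∈ sphereSqrtDomain n) ∧
      IntegrableOn (sqrtTerm (γ - 4) f) (Ioi 0) ∧
      IntegrableOn (sqrtDerivTerm (γ - 2) f) (Ioi 0) ∧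
      IntegrableOn (lapTerm (γ - 4) f) (Ioi 0)) ∧
    ((∫ x, ‖x‖ ^ γ * ‖Laplacian.laplacian f x‖ ^ 2) ≥
      (α * (γ + n - 4) - 2 * β) * (∫ x, ‖x‖ ^ (γ - 2) * gradSq f x)
      - α * (α - 4 + 2 * γ) * (∫ x, ‖x‖ ^ (γ - 4) * ‖fderiv ℝ f x x‖ ^ 2)
      + β * ((n - 4) * (α - 2) - β + γ * (n + α + γ - 6)) *
          (∫ x, ‖x‖ ^ (γ - 4) * ‖f x‖ ^ 2)
      - τ * ((γ + n - 4) * (2 - α - γ) + 2 * β) * (∫ r in Ioi (0 : ℝ), sqrtTerm (γ - 4) f r)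
      - 2 * τ * (∫ r in Ioi (0 : ℝ), sqrtDerivTerm (γ - 2) f r)
      - τ * (τ + 2) * (∫ r in Ioi (0 : ℝ), lapTerm (γ - 4) f r)) ∧
    (0 ≤ α * (α - 4 + 2 * γ) →
      (∫ x, ‖x‖ ^ γ * ‖Laplacian.laplacian f x‖ ^ 2) ≥
        (α * (n - α - γ) - 2 * β) * (∫ x, ‖x‖ ^ (γ - 2) * gradSq f x)
        + β * ((n - 4) * (α - 2) - β + γ * (n + α + γ - 6)) *
            (∫ x, ‖x‖ ^ (γ - 4) * ‖f x‖ ^ 2)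
        - τ * ((γ + n - 4) * (2 - α - γ) + 2 * β) * (∫ r in Ioi (0 : ℝ), sqrtTerm (γ - 4) f r)
        - 2 * τ * (∫ r in Ioi (0 : ℝ), sqrtDerivTerm (γ - 2) f r)
        - τ * (τ + 2) * (∫ r in Ioi (0 : ℝ), lapTerm (γ - 4) f r)) := by
  have hn0 : 0 < n := by omega
  have hT : IsTest f := ⟨hf, hfc, hf0⟩
  obtain ⟨iA, eA⟩ := integrableOn_and_integral_sqrtTerm hn0 hT (γ - 4)
  obtain ⟨iB, eB⟩ := integrableOn_and_integral_sqrtDerivTerm hn0 hT γ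
  obtain ⟨iC, eC⟩ := integrableOn_and_integral_lapTerm hn0 hT (γ - 4)
  have eE : ∫ x : EuclideanSpace ℝ (Fin n), ‖x‖ ^ (γ - 4) * ‖fderiv ℝ f x x‖ ^ 2
      = pairing (fun x => ‖x‖ ^ (γ - 4)) (linDeriv (.id ℝ _) f) (linDeriv (.id ℝ _) f) := by
    simp only [pairing, real_inner_self_eq_norm_sq]
    rfl
  have eP : ∫ x : EuclideanSpace ℝ (Fin n), ‖x‖ ^ (γ - 4) * ‖f x‖ ^ 2
      = pairing (fun x => ‖x‖ ^ (γ - 4)) f f := by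
    simp only [pairing, real_inner_self_eq_norm_sq]
  have eG := integral_gradSq hn0 γ hT
  have hAnn := pairing_angLaplacian_self_nonpos (γ - 4) hT
  have hR := integral_laplacian_sq hn0 γ hT rfl
  rw [pairing_self_combination hn0 (γ - 4) hT _ _ _ _ rfl eA eB eC eE eP] at hR
  -- The square of `r² Δf - (α r ∂_r f + β f - τ Δ_S f)`; its nonnegativity is the inequality.
  have hS := pairing_self_combination hn0 (γ - 4) hT 1 (n - 2 - α) (1 + τ) (-β) rfl eA eB eC eE eP
  have hS0 : 0 ≤ pairing (fun x => ‖x‖ ^ (γ - 4)) (fun x =>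
      (1 : ℝ) • linDeriv (.id ℝ _) (linDeriv (.id ℝ _) f) x + (n - 2 - α) • linDeriv (.id ℝ _) f x
        + (1 + τ) • angLaplacian f x + (-β) • f x) (fun x =>
      (1 : ℝ) • linDeriv (.id ℝ _) (linDeriv (.id ℝ _) f) x + (n - 2 - α) • linDeriv (.id ℝ _) f x
        + (1 + τ) • angLaplacian f x + (-β) • f x) :=
    integral_nonneg fun x => mul_nonneg (by positivity) real_inner_self_nonneg
  rw [hS] at hS0
  have main : (∫ x, ‖x‖ ^ γ * ‖Laplacian.laplacian f x‖ ^ 2) ≥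
      (α * (γ + n - 4) - 2 * β) * (∫ x, ‖x‖ ^ (γ - 2) * gradSq f x)
      - α * (α - 4 + 2 * γ) * (∫ x, ‖x‖ ^ (γ - 4) * ‖fderiv ℝ f x x‖ ^ 2)
      + β * ((n - 4) * (α - 2) - β + γ * (n + α + γ - 6)) *
          (∫ x, ‖x‖ ^ (γ - 4) * ‖f x‖ ^ 2)
      - τ * ((γ + n - 4) * (2 - α - γ) + 2 * β) * (∫ r in Ioi (0 : ℝ), sqrtTerm (γ - 4) f r)
      - 2 * τ * (∫ r in Ioi (0 : ℝ), sqrtDerivTerm (γ - 2) f r)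
      - τ * (τ + 2) * (∫ r in Ioi (0 : ℝ), lapTerm (γ - 4) f r) := by
    rw [hR, eG, sub_eq_add_neg (pairing _ _ _), ← eA, ← eE]
    linarith
  refine ⟨⟨fun r hr => ⟨?_, ?_⟩, iA, iB, iC⟩, main, fun hα => ?_⟩
  · exact (mem_sphereSqrtDomain_and_norm_sq hn0 (sphereSmooth_polar hT.contDiffOn hr)).1
  · rw [toSphereL2_polarDeriv hT hr]
    exact Submodule.smul_mem _ _ (mem_sphereSqrtDomain_and_norm_sq hn0
      (sphereSmooth_polar (contDiffOn_linDeriv _ hT.contDiffOn) hr)).1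
  · -- The radial part of `|∇f|²` is at most `|∇f|²`.
    have hle : (∫ x : EuclideanSpace ℝ (Fin n), ‖x‖ ^ (γ - 4) * ‖fderiv ℝ f x x‖ ^ 2)
        ≤ ∫ x, ‖x‖ ^ (γ - 2) * gradSq f x := by
      rw [eE, eG]
      linarith
    have := mul_le_mul_of_nonneg_left hle hα
    linarith
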